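/- **Programs.** Fix a set of symbolic constants and a set of program variables. Ground terms are the numerals $\overline n$ ($n\in\mathbb Z$), the symbolic constants, and two special symbols $\mathit{inf},\mathit{sup}$; they carry a chosen total order with least element $\mathit{inf}$ and greatest element $\mathit{sup}$, in which numerals are ordered as integers and precede all symbolic constants. Program terms are ground terms and variables. Atomic formulas are atoms $p(t_1,\dots,t_n)$ ($p$ a symbolic constant; the predicate symbol of the atom is $p/n$) and comparisons $t\prec t'$ with $\prec$ one of $=,\ne,<,>,\le,\ge$; a basic literal is an atomic formula preceded by at most two occurrences of $\mathit{not}$. An aggregate element $E$ has the form $t_1,\dots,t_k:l_1,\dots,l_m$ with basic literals $l_i$; an aggregate literal is an aggregate atom $\#\mathit{op}\{E\}\prec u$, $\mathit{op}\in\{\mathit{count},\mathit{sum}\}$, preceded by at most two occurrences of $\mathit{not}$. A rule is $\mathit{Head}\leftarrow B_1,\dots,B_n$, where $\mathit{Head}$ is an atom or $\bot$ and each $B_i$ is a basic or aggregate literal; a program $\Pi$ is a (possibly infinite) set of rules, in which aggregates may be recursive. A variable is global in a rule if it occurs in the head, in a basic literal of the body, or in the guard $u$ of an aggregate literal. The set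 symbol $E/\mathbf X$ occurs in a rule if $E$ occurs in it and $\mathbf X$ lists the variables of $E$ that are global in the rule; $\mathbf Y$ lists the other variables of $E$. For a set $\Delta$ of tuples of ground terms, $\widehat{\mathit{count}}(\Delta)$ is $|\Delta|$ if $\Delta$ is finite and $\mathit{sup}$ otherwise; $\widehat{\mathit{sum}}(\Delta)$ is the sum of the weights of the tuples in $\Delta$ if finitely many of them are non-zero and $0$ otherwise, where the weight of a tuple is $n$ if its first member is $\overline n$, and $0$ otherwise. **First-order side.** The signature $\sigma$ of $\Pi$ has the sorts general, tuple and set; the ground terms as object constants; the predicate symbols $p/n$ occurring in $\Pi$; the comparison symbols other than $=$; $\in$; tuple constructors for the lengths $k$ of the occurring aggregate elements; $\mathit{count},\mathit{sum}$ from sets to general; and for each occurring set symbol two function symbols $s^{cli}_{E/\mathbf X}$, $s^{dlv}_{E/\mathbf X}$ from tuples of general arguments to sets. The predicates $p/n$ and the functions $s^{x}_{E/\mathbf X}$ are intensional. Formulas are built from atomic formulas (including equalities) with $\bot,\wedge,\vee,\to,\forall,\exists$ and an extra classical negation ${\sim}$; $\neg F$ is $F\to\bot$. For $H,I$ with the same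 universes, $H\preceq I$ means $p^H\subseteq p^I$ for intensional $p$, and that $H,I$ agree on all non-intensional symbols; $H\prec I$ means $H\preceq I$ and $H\ne I$. Here-and-there satisfaction by $\langle H,I\rangle$, where $H\preceq I$, is given by: an atomic sentence holds if it holds in both $H$ and $I$; ${\sim}F$ holds if $F$ is false in both $H$ and $I$; $F\to G$ holds if it holds classically in $I$ and $\langle H,I\rangle$ does not satisfy $F$ or satisfies $G$; the other connectives and the quantifiers are treated as usual. The translation $\tau^{cli}\Pi$ consists of the universal closures of $\tau B_1\wedge\dots\wedge\tau B_n\to\mathit{Head}$ for all rules, where $\tau$ leaves atomic formulas unchanged, turns $\#\mathit{op}\{E\}\prec u$ into $\mathit{op}(s^{cli}_{E/\mathbf X}(\mathbf X))\prec u$, and turns $\mathit{not}$ into $\neg$; $\tau^{dlv}$ uses $s^{dlv}$ and ${\sim}$ instead. A standard interpretation has as universes all ground terms, all tuples of ground terms of the lengths $k$ above, and all sets of such tuples, and interprets ground terms, comparisons, $\in$, tuple constructors, $\mathit{count}$ and $\mathit{sum}$ as intended. It is an agg-interpretation $I$ if, for every set symbol, $x\in\{cli,dlv\}$ and $\mathbf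 x$, the set $s^{x}_{E/\mathbf X}(\mathbf x)^I$ consists of the tuples $(t_1,\dots,t_k)^{\mathbf X\mathbf Y}_{\mathbf x\mathbf y}$, $\mathbf y$ ranging over tuples of ground terms, such that $I\models\bigwedge_i\tau^x(l_i)^{\mathbf X\mathbf Y}_{\mathbf x\mathbf y}$. An agg-ht-interpretation is a pair $\langle H,I\rangle$ of standard interpretations with $H\preceq I$, $I$ an agg-interpretation, $s^{cli}_{E/\mathbf X}(\mathbf x)^H$ the set of those tuples for which $\langle H,I\rangle$ satisfies $\bigwedge_i\tau^{cli}(l_i)^{\mathbf X\mathbf Y}_{\mathbf x\mathbf y}$ in the sense of here-and-there, and $s^{dlv}_{E/\mathbf X}(\mathbf x)^H$ the set of those for which $H\models\bigwedge_i\tau^{dlv}(l_i)^{\mathbf X\mathbf Y}_{\mathbf x\mathbf y}$. An agg-interpretation $I$ satisfying a set $\Gamma$ of sentences is an agg-stable model of $\Gamma$ if no agg-ht-interpretation $\langle H,I\rangle$ with $H\prec I$ satisfies $\Gamma$. Let $\mathrm{SCA}$ be the set of the axioms $\forall\mathbf X\,T\,\bigl(T\in s^{cli}_{E/\mathbf X}(\mathbf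 X)\leftrightarrow\exists\mathbf Y(T=\mathit{tuple}(t_1,\dots,t_k)\wedge\tau^{cli}l_1\wedge\dots\wedge\tau^{cli}l_m)\bigr)$ for the set symbols occurring in $\Pi$. **Gringo answer sets.** For a substitution $\mathbf z$ of ground terms for the global variables of a rule, $\tau$ maps ground atoms to themselves, true ground comparisons to $\top$ and false ones to $\bot$, $\mathit{not}$ to $\neg$, and an instance of an aggregate atom $\#\mathit{op}\{E\}\prec u$ to the infinitary formula $\bigwedge_{\Delta}\bigl(\bigwedge_{\mathbf y\in\Delta}\mathbf l_{\mathbf y}\to\bigvee_{\mathbf y\notin\Delta}\mathbf l_{\mathbf y}\bigr)$, where $\mathbf l_{\mathbf y}$ is the conjunction of the translated literals of $E$ with its local variables replaced by $\mathbf y$, and $\Delta$ ranges over the sets of tuples $\mathbf y$ for which the relation $\prec$ does not hold between $\widehat{\mathit{op}}(\{\mathbf t_{\mathbf y}:\mathbf y\in\Delta\})$ and $u$. $\tau\Pi$ is the conjunction of $\tau B_1\wedge\dots\wedge\tau B_n\to\tau\mathit{Head}$ over all rules and all $\mathbf z$. A set $A$ of ground atoms is a gringo answer set of $\Pi$ if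 it is a $\subseteq$-minimal model of the FT-reduct $(\tau\Pi)^A$, where $p^A$ is $p$ if $p\in A$ and $\bot$ otherwise, reducts commute with conjunctions and disjunctions, and $(F\to G)^A$ is $F^A\to G^A$ if $A\models F\to G$ and $\bot$ otherwise. **Theorem.** For every program $\Pi$, the sets of ground atoms $p(t_1,\dots,t_n)$ satisfied by the agg-stable models of $\tau^{cli}\Pi$ are exactly the gringo answer sets of $\Pi$; and the same holds for the agg-stable models of $\mathrm{SCA}\cup\tau^{cli}\Pi$. -/

import Mathlib

namespace AspAgg

/-! ### Syntax of programs with aggregates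

`Con` is the set of symbolic constants (they also serve as names of predicates),
`Var` the set of program variables. -/

/-- Ground (variable-free) program terms. -/
inductive GroundTerm (Con : Type) : Type
  | inf : GroundTerm Con
  | num (n : ℤ) : GroundTerm Con
  | con (c : Con) : GroundTerm Con
  | sup : GroundTerm Con

/-- The chosen total order on ground terms. -/
class TermOrder (Con : Type) extends LinearOrder (GroundTerm Con) where
  inf_le : ∀ t : GroundTerm Con, GroundTerm.inf ≤ t
  le_sup : ∀ t : GroundTerm Con, t ≤ GroundTerm.sup
  num_lt_num : ∀ m n : ℤ, (GroundTerm.num m : GroundTerm Con) < GroundTerm.num n ↔ m < n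
  num_lt_con : ∀ (n : ℤ) (c : Con), GroundTerm.num n < GroundTerm.con c

/-- Program terms. -/
inductive ProgTerm (Con Var : Type) : Type
  | ground (g : GroundTerm Con) : ProgTerm Con Var
  | var (v : Var) : ProgTerm Con Var

/-- The six comparison symbols. -/
inductive Cmp : Type
  | eq | ne | lt | gt | le | ge
  deriving DecidableEq

/-- The relation on ground terms denoted by a comparison symbol. -/
def Cmp.Rel {Con : Type} [TermOrder Con] (c : Cmp) (s t : GroundTerm Con) : Prop :=
  match c with
  | .eq => s = t
  | .ne => s ≠ t
  | .lt => s < t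
  | .gt => t < s
  | .le => s ≤ t
  | .ge => t ≤ s

/-- An atom `p(t₁, …, tₙ)` whose arguments are in `T`; the predicate symbol of the atom is `p/n`. -/
structure Atom (Con T : Type) : Type where
  pred : Con
  args : List T

/-- A predicate symbol `p/n`. -/
abbrev PredSymbol (Con : Type) : Type := Con × ℕ

/-- Ground atoms of the program signature. -/
abbrev GroundAtom (Con : Type) : Type := Atom Con (GroundTerm Con)

/-- Atomic formulas of programs: atoms and comparisons. -/
inductive AtomicFormula (Con Var : Type) : Type
  | atom (a : Atom Con (ProgTerm Con Var)) : AtomicFormula Con Var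
  | cmp (c : Cmp) (s t : ProgTerm Con Var) : AtomicFormula Con Var

/-- Zero, one or two occurrences of `not` in front of an atomic formula or aggregate atom. -/
inductive Sign : Type
  | pos | not | notNot

structure BasicLiteral (Con Var : Type) : Type where
  sign : Sign
  form : AtomicFormula Con Var

/-- An aggregate element `t₁, …, tₖ : l₁, …, lₘ`. -/
structure AggElement (Con Var : Type) : Type where
  terms : List (ProgTerm Con Var)
  lits : List (BasicLiteral Con Var)

/-- Operation names. -/
inductive Op : Type
  | count | sum

/-- An aggregate atom `#op{E} ≺ u`. -/
structure AggAtom (Con Var : Type) : Type where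
  op : Op
  elem : AggElement Con Var
  cmp : Cmp
  guard : ProgTerm Con Var

inductive Literal (Con Var : Type) : Type
  | basic (l : BasicLiteral Con Var) : Literal Con Var
  | agg (sign : Sign) (a : AggAtom Con Var) : Literal Con Var

/-- A rule `Head :- B₁, …, Bₙ`; the head `none` stands for `⊥`. -/
structure Rule (Con Var : Type) : Type where
  head : Option (Atom Con (ProgTerm Con Var))
  body : List (Literal Con Var)

/-- A program is a (possibly infinite) set of rules. -/
abbrev Program (Con Var : Type) : Type := Set (Rule Con Var)

/-! ### Variables, predicate symbols and set symbols occurring in expressions -/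

/-- The union of the finite sets `f a`, for `a` in the list `l`. -/
def unionOver {α Var : Type} [DecidableEq Var] (f : α → Finset Var) (l : List α) : Finset Var :=
  l.foldr (fun a s => f a ∪ s) ∅

theorem mem_unionOver {α Var : Type} [DecidableEq Var] {f : α → Finset Var} {l : List α}
    {a : α} {v : Var} (ha : a ∈ l) (hv : v ∈ f a) : v ∈ unionOver f l := by
  induction l with
  | nil => simp at ha
  | cons b l ih =>
    rcases List.mem_cons.1 ha with rfl | h
    · exact Finset.mem_union_left _ hv
    · exact Finset.mem_union_right _ (ih h)

def ProgTerm.vars {Con Var : Type} : ProgTerm Con Var → Finset Var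
  | .ground _ => ∅
  | .var v => {v}

/-- The predicate symbol `p/n` of an atom. -/
def Atom.symbol {Con T : Type} (a : Atom Con T) : PredSymbol Con := (a.pred, a.args.length)

def AtomicFormula.preds {Con Var : Type} : AtomicFormula Con Var → Set (PredSymbol Con)
  | .atom a => {a.symbol}
  | .cmp _ _ _ => ∅

def AggElement.preds {Con Var : Type} (E : AggElement Con Var) : Set (PredSymbol Con) :=
  {p | ∃ l ∈ E.lits, p ∈ l.form.preds}

def Literal.preds {Con Var : Type} : Literal Con Var → Set (PredSymbol Con)
  | .basic l => l.form.preds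
  | .agg _ a => a.elem.preds

def Rule.preds {Con Var : Type} (R : Rule Con Var) : Set (PredSymbol Con) :=
  {p | (∃ a, R.head = some a ∧ p = a.symbol) ∨ ∃ l ∈ R.body, p ∈ l.preds}

/-- The predicate symbols occurring in a program. -/
def Program.preds {Con Var : Type} (prog : Program Con Var) : Set (PredSymbol Con) :=
  {p | ∃ R ∈ prog, p ∈ R.preds}

theorem Program.preds_subset {Con Var : Type} {prog : Program Con Var} {R : Rule Con Var} (hR : R ∈ prog) :
    R.preds ⊆ prog.preds := fun _ hp => ⟨R, hR, hp⟩

section Occurrences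

variable {Con Var : Type} [DecidableEq Var]

def AtomicFormula.vars : AtomicFormula Con Var → Finset Var
  | .atom a => unionOver ProgTerm.vars a.args
  | .cmp _ s t => s.vars ∪ t.vars

def AggElement.vars (E : AggElement Con Var) : Finset Var :=
  unionOver ProgTerm.vars E.terms ∪ unionOver (fun l => l.form.vars) E.lits

/-- The variables of a literal that are global in every rule whose body contains it: all variables
of a basic literal, the variables in the guard of an aggregate literal. -/
def Literal.globalVars : Literal Con Var → Finset Var
  | .basic l => l.form.vars
  | .agg _ a => a.guard.vars

def headVars : Option (Atom Con (ProgTerm Con Var)) → Finset Var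
  | none => ∅
  | some a => unionOver ProgTerm.vars a.args

/-- The global variables of a rule: those that occur in a non-aggregate literal (the head
included) or in the guard of an aggregate literal. -/
def Rule.globalVars (R : Rule Con Var) : Finset Var :=
  headVars R.head ∪ unionOver Literal.globalVars R.body

variable (Con Var) in
/-- A set symbol `E/X`. The list `X` is represented by the set of its members, and tuples of the
same length as `X` by functions on this set. -/
structure SetSymbol : Type where
  elem : AggElement Con Var
  params : Finset Var
  params_subset : params ⊆ elem.vars

/-- The set symbol `E/X` where `X` consists of all variables of `E` that belong to `Z`. -/
def AggElement.setSymbol (E : AggElement Con Var) (Z : Finset Var) : SetSymbol Con Var :=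
  ⟨E, E.vars ∩ Z, Finset.inter_subset_left⟩

def Literal.setSymbols (Z : Finset Var) : Literal Con Var → Set (SetSymbol Con Var)
  | .basic _ => ∅
  | .agg _ a => {a.elem.setSymbol Z}

def Rule.setSymbols (R : Rule Con Var) : Set (SetSymbol Con Var) :=
  {e | ∃ l ∈ R.body, e ∈ l.setSymbols R.globalVars}

/-- The set symbols occurring in a program. -/
def Program.setSymbols (prog : Program Con Var) : Set (SetSymbol Con Var) :=
  {e | ∃ R ∈ prog, e ∈ R.setSymbols}

theorem Program.setSymbols_subset {prog : Program Con Var} {R : Rule Con Var} (hR : R ∈ prog) :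
    R.setSymbols ⊆ prog.setSymbols := fun _ he => ⟨R, hR, he⟩

end Occurrences

/-! ### Substitution of ground terms, and the functions denoted by operation names -/

/-- The ground term obtained from `t` by the substitution `θ`. -/
def ProgTerm.inst {Con Var : Type} (θ : Var → GroundTerm Con) : ProgTerm Con Var → GroundTerm Con
  | .ground g => g
  | .var v => θ v

def Atom.inst {Con Var : Type} (θ : Var → GroundTerm Con) (a : Atom Con (ProgTerm Con Var)) :
    GroundAtom Con :=
  ⟨a.pred, a.args.map (ProgTerm.inst θ)⟩

/-- The weight of a tuple of ground terms. -/
def weight {Con : Type} : List (GroundTerm Con) → ℤ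
  | .num n :: _ => n
  | _ => 0

open Classical in
/-- The function denoted by an operation name: it maps sets of tuples of ground terms to ground
terms. -/
noncomputable def Op.hat {Con : Type} (op : Op) (Δ : Set (List (GroundTerm Con))) :
    GroundTerm Con :=
  match op with
  | .count => if Δ.Finite then .num (Δ.ncard : ℤ) else .sup
  | .sum => if {t ∈ Δ | weight t ≠ 0}.Finite then .num (∑ᶠ t ∈ Δ, weight t) else .num 0

/-! ### Many-sorted logic of here-and-there with intensional functions -/

/-- A many-sorted signature. The argument places of a function or predicate constant form a finite
type. The subsort relation is equality. -/
structure Signature : Type 1 where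
  Srt : Type
  Func : Type
  Pred : Type
  FArg : Func → Type
  finite_FArg : ∀ f, Finite (FArg f)
  fdom : ∀ f, FArg f → Srt
  fval : Func → Srt
  PArg : Pred → Type
  finite_PArg : ∀ p, Finite (PArg p)
  pdom : ∀ p, PArg p → Srt
  /-- object variables of each sort -/
  OVar : Srt → Type

/-- A list of sorted object variables. -/
abbrev Signature.Ctx (σ : Signature) : Type := List (Σ s, σ.OVar s)

/-- Terms of a given sort whose variables belong to `C`. -/
inductive Term (σ : Signature) (C : σ.Ctx) : σ.Srt → Type
  | var (x : Σ s, σ.OVar s) (h : x ∈ C) : Term σ C x.1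
  | app (f : σ.Func) (ts : ∀ i : σ.FArg f, Term σ C (σ.fdom f i)) : Term σ C (σ.fval f)

/-- Extended first-order formulas whose free variables belong to `C`; `sneg` is the additional
negation connective. -/
inductive Formula (σ : Signature) : σ.Ctx → Type
  | bot {C : σ.Ctx} : Formula σ C
  | pred {C : σ.Ctx} (p : σ.Pred) (ts : ∀ i : σ.PArg p, Term σ C (σ.pdom p i)) : Formula σ C
  | eq {C : σ.Ctx} {s : σ.Srt} (t₁ t₂ : Term σ C s) : Formula σ C
  | sneg {C : σ.Ctx} (F : Formula σ C) : Formula σ C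
  | and {C : σ.Ctx} (F G : Formula σ C) : Formula σ C
  | or {C : σ.Ctx} (F G : Formula σ C) : Formula σ C
  | imp {C : σ.Ctx} (F G : Formula σ C) : Formula σ C
  | all {C : σ.Ctx} (x : Σ s, σ.OVar s) (F : Formula σ (x :: C)) : Formula σ C
  | ex {C : σ.Ctx} (x : Σ s, σ.OVar s) (F : Formula σ (x :: C)) : Formula σ C

/-- Sentences are formulas without free variables. -/
abbrev Sentence (σ : Signature) : Type := Formula σ []

section Abbreviations

variable {σ : Signature} {C : σ.Ctx}

def Formula.neg (F : Formula σ C) : Formula σ C := .imp F .bot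

def Formula.top : Formula σ C := .neg .bot

def Formula.iff (F G : Formula σ C) : Formula σ C := .and (.imp F G) (.imp G F)

/-- The conjunction of a list of formulas. -/
def Formula.conj (l : List (Formula σ C)) : Formula σ C := l.foldr .and .top

/-- `∀ L F`, for a list `L` of variables. -/
def Formula.alls : (L : σ.Ctx) → Formula σ (L ++ C) → Formula σ C
  | [], F => F
  | x :: L, F => Formula.alls L (.all x F)

/-- `∃ L F`, for a list `L` of variables. -/
def Formula.exs : (L : σ.Ctx) → Formula σ (L ++ C) → Formula σ C
  | [], F => F
  | x :: L, F => Formula.exs L (.ex x F)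

end Abbreviations

/-- An interpretation with universes `U s`. -/
structure Interp (σ : Signature) (U : σ.Srt → Type) : Type where
  func : ∀ f : σ.Func, (∀ i : σ.FArg f, U (σ.fdom f i)) → U (σ.fval f)
  pred : ∀ p : σ.Pred, (∀ i : σ.PArg p, U (σ.pdom p i)) → Prop

/-- Assignments of elements of the universes to the variables in `C`. -/
abbrev Assign {σ : Signature} (U : σ.Srt → Type) (C : σ.Ctx) : Type :=
  ∀ x : Σ s, σ.OVar s, x ∈ C → U x.1

def Assign.empty {σ : Signature} {U : σ.Srt → Type} : Assign U ([] : σ.Ctx) :=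
  fun _ h => absurd h List.not_mem_nil

open Classical in
/-- Extend an assignment by giving the value `d` to the variable `x`. -/
noncomputable def Assign.cons {σ : Signature} {U : σ.Srt → Type} {C : σ.Ctx} (ρ : Assign U C)
    (x : Σ s, σ.OVar s) (d : U x.1) : Assign U (x :: C) :=
  fun y hy => if h : y = x then h ▸ d else ρ y ((List.mem_cons.1 hy).resolve_left h)

section Satisfaction

variable {σ : Signature} {U : σ.Srt → Type}

def Term.eval (I : Interp σ U) {C : σ.Ctx} (ρ : Assign U C) : {s : σ.Srt} → Term σ C s → U s
  | _, .var x h => ρ x h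
  | _, .app f ts => I.func f (fun i => (ts i).eval I ρ)

/-- Classical satisfaction. -/
def Formula.Sat (I : Interp σ U) : {C : σ.Ctx} → Formula σ C → Assign U C → Prop
  | _, .bot, _ => False
  | _, .pred p ts, ρ => I.pred p (fun i => (ts i).eval I ρ)
  | _, .eq t₁ t₂, ρ => t₁.eval I ρ = t₂.eval I ρ
  | _, .sneg F, ρ => ¬ F.Sat I ρ
  | _, .and F G, ρ => F.Sat I ρ ∧ G.Sat I ρ
  | _, .or F G, ρ => F.Sat I ρ ∨ G.Sat I ρ
  | _, .imp F G, ρ => F.Sat I ρ → G.Sat I ρ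
  | _, .all x F, ρ => ∀ d : U x.1, F.Sat I (ρ.cons x d)
  | _, .ex x F, ρ => ∃ d : U x.1, F.Sat I (ρ.cons x d)

/-- Satisfaction in the pair `⟨H, I⟩`. -/
def Formula.HTSat (H I : Interp σ U) : {C : σ.Ctx} → Formula σ C → Assign U C → Prop
  | _, .bot, _ => False
  | _, .pred p ts, ρ =>
      I.pred p (fun i => (ts i).eval I ρ) ∧ H.pred p (fun i => (ts i).eval H ρ)
  | _, .eq t₁ t₂, ρ => t₁.eval I ρ = t₂.eval I ρ ∧ t₁.eval H ρ = t₂.eval H ρ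
  | _, .sneg F, ρ => ¬ F.Sat I ρ ∧ ¬ F.Sat H ρ
  | _, .and F G, ρ => F.HTSat H I ρ ∧ G.HTSat H I ρ
  | _, .or F G, ρ => F.HTSat H I ρ ∨ G.HTSat H I ρ
  | _, .imp F G, ρ => (F.imp G).Sat I ρ ∧ (¬ F.HTSat H I ρ ∨ G.HTSat H I ρ)
  | _, .all x F, ρ => ∀ d : U x.1, F.HTSat H I (ρ.cons x d)
  | _, .ex x F, ρ => ∃ d : U x.1, F.HTSat H I (ρ.cons x d)

/-- `I` is a model of the set `Γ` of sentences. -/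
def Interp.Models (I : Interp σ U) (Γ : Set (Sentence σ)) : Prop :=
  ∀ F ∈ Γ, F.Sat I Assign.empty

/-- `⟨H, I⟩` satisfies the set `Γ` of sentences. -/
def HTModels (H I : Interp σ U) (Γ : Set (Sentence σ)) : Prop :=
  ∀ F ∈ Γ, F.HTSat H I Assign.empty

/-- `H ≼ I` for intensional predicate constants `P` and intensional function constants `F`; that
is, `⟨H, I⟩` is an ht-interpretation. -/
def HTLe (P : Set σ.Pred) (F : Set σ.Func) (H I : Interp σ U) : Prop :=
  (∀ p ∈ P, ∀ a, H.pred p a → I.pred p a) ∧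
  (∀ p ∉ P, H.pred p = I.pred p) ∧
  ∀ f ∉ F, H.func f = I.func f

/-- `H ≺ I`. -/
def HTLt (P : Set σ.Pred) (F : Set σ.Func) (H I : Interp σ U) : Prop :=
  HTLe P F H I ∧ H ≠ I

end Satisfaction

/-! ### The target signature -/

/-- The two semantics for set symbols. -/
inductive Sem : Type
  | cli | dlv

/-- The three sorts: general, tuple, set. -/
inductive TSort : Type
  | gen | tuple | set

section Target

variable {Con Var : Type} [DecidableEq Var]

/-- Function constants of `σ(P, S)`. -/
inductive TFunc (S : Set (SetSymbol Con Var)) : Type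
  | const (g : GroundTerm Con) : TFunc S
  | tuple (k : ℕ) (h : ∃ e ∈ S, e.elem.terms.length = k) : TFunc S
  | op (o : Op) : TFunc S
  | setFn (x : Sem) (e : SetSymbol Con Var) (h : e ∈ S) : TFunc S

/-- The two argument places of the membership predicate. -/
inductive MemArg : Type
  | left | right

/-- Predicate constants of `σ(P, S)`. -/
inductive TPred (P : Set (PredSymbol Con)) : Type
  | user (p : PredSymbol Con) (h : p ∈ P) : TPred P
  | cmp (c : Cmp) (h : c ≠ .eq) : TPred P
  | mem : TPred P

def TFunc.Arg {S : Set (SetSymbol Con Var)} : TFunc S → Type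
  | .const _ => Empty
  | .tuple k _ => Fin k
  | .op _ => Unit
  | .setFn _ e _ => e.params

def TFunc.dom {S : Set (SetSymbol Con Var)} : (f : TFunc S) → f.Arg → TSort
  | .const _, _ => .gen
  | .tuple _ _, _ => .gen
  | .op _, _ => .set
  | .setFn _ _ _, _ => .gen

def TFunc.val {S : Set (SetSymbol Con Var)} : TFunc S → TSort
  | .const _ => .gen
  | .tuple _ _ => .tuple
  | .op _ => .gen
  | .setFn _ _ _ => .set

def TPred.Arg {P : Set (PredSymbol Con)} : TPred P → Type
  | .user p _ => Fin p.2
  | .cmp _ _ => Fin 2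
  | .mem => MemArg

def TPred.dom {P : Set (PredSymbol Con)} : (p : TPred P) → p.Arg → TSort
  | .user _ _, _ => .gen
  | .cmp _ _, _ => .gen
  | .mem, .left => .tuple
  | .mem, .right => .set

/-- The signature `σ(P, S)`. The object variables of the general sort are the program variables. -/
@[reducible]
def target (P : Set (PredSymbol Con)) (S : Set (SetSymbol Con Var)) : Signature where
  Srt := TSort
  Func := TFunc S
  Pred := TPred P
  FArg := TFunc.Arg
  finite_FArg := by
    rintro (g | ⟨k, h⟩ | o | ⟨x, e, h⟩)
    · exact inferInstanceAs (Finite Empty)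
    · exact inferInstanceAs (Finite (Fin k))
    · exact inferInstanceAs (Finite Unit)
    · exact inferInstanceAs (Finite e.params)
  fdom := TFunc.dom
  fval := TFunc.val
  PArg := TPred.Arg
  finite_PArg := by
    rintro (⟨p, h⟩ | ⟨c, h⟩ | _)
    · exact inferInstanceAs (Finite (Fin p.2))
    · exact inferInstanceAs (Finite (Fin 2))
    · exact Finite.of_surjective (fun i : Fin 2 => if i = 0 then MemArg.left else .right)
        (by rintro (_ | _); exacts [⟨0, rfl⟩, ⟨1, rfl⟩])
  pdom := TPred.dom
  OVar := fun s => match s with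
    | .gen => Var
    | .tuple => ℕ
    | .set => ℕ

variable {P : Set (PredSymbol Con)} {S : Set (SetSymbol Con Var)}

/-- A program variable as an object variable of the general sort. -/
def genVar (v : Var) : Σ s, (target P S).OVar s := ⟨.gen, v⟩

/-- A finite set of program variables, as a list of object variables in some order. -/
noncomputable def genCtx (Z : Finset Var) : (target P S).Ctx := Z.toList.map genVar

/-- All program variables in `Z` are available in the context `C`. -/
def Covers (C : (target P S).Ctx) (Z : Finset Var) : Prop := ∀ v ∈ Z, genVar v ∈ C

theorem covers_genCtx_append (Z : Finset Var) (C : (target P S).Ctx) :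
    Covers (genCtx Z ++ C) Z := fun v hv =>
  List.mem_append_left _ (List.mem_map.2 ⟨v, Finset.mem_toList.2 hv, rfl⟩)

/-! ### Translations into sentences over the target signature

The hypotheses of the functions below say that all symbols needed belong to the signature and that
all variables are in scope. -/

def ProgTerm.toFO {C : (target P S).Ctx} :
    (t : ProgTerm Con Var) → Covers C t.vars → Term (target P S) C TSort.gen
  | .ground g, _ => Term.app (σ := target P S) (TFunc.const g) (fun i : Empty => nomatch i)
  | .var v, h => .var (genVar v) (h v (Finset.mem_singleton_self v))

/-- The formula `s ≺ t`. -/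
def cmpFO {C : (target P S).Ctx} (c : Cmp) (s t : Term (target P S) C TSort.gen) :
    Formula (target P S) C :=
  if h : c = .eq then .eq s t
  else .pred (TPred.cmp c h) (fun i : Fin 2 => if i = 0 then s else t)

/-- The formula `t ∈ s`. -/
def memFO {C : (target P S).Ctx} (t : Term (target P S) C TSort.tuple)
    (s : Term (target P S) C TSort.set) : Formula (target P S) C :=
  .pred TPred.mem (fun i => match i with
    | .left => t
    | .right => s)

/-- An atom whose predicate symbol belongs to `P`. -/
def Atom.toFO {C : (target P S).Ctx} (a : Atom Con (ProgTerm Con Var)) (hP : a.symbol ∈ P)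
    (hC : Covers C (unionOver ProgTerm.vars a.args)) : Formula (target P S) C :=
  .pred (TPred.user a.symbol hP) (fun i : Fin a.args.length =>
    (a.args.get i).toFO (fun v hv => hC v (mem_unionOver (a.args.get_mem i) hv)))

def AtomicFormula.toFO {C : (target P S).Ctx} :
    (A : AtomicFormula Con Var) → A.preds ⊆ P → Covers C A.vars → Formula (target P S) C
  | .atom a, hP, hC => a.toFO (hP rfl) hC
  | .cmp c s t, _, hC => cmpFO c
      (s.toFO fun v hv => hC v (Finset.mem_union_left _ hv))
      (t.toFO fun v hv => hC v (Finset.mem_union_right _ hv))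

/-- Translation of `not`: standard negation for `cli`, the additional negation for `dlv`. -/
def Sem.neg {σ : Signature} {C : σ.Ctx} (x : Sem) (F : Formula σ C) : Formula σ C :=
  match x with
  | .cli => .neg F
  | .dlv => .sneg F

def Sign.toFO {σ : Signature} {C : σ.Ctx} (sgn : Sign) (x : Sem) (F : Formula σ C) :
    Formula σ C :=
  match sgn with
  | .pos => F
  | .not => x.neg F
  | .notNot => x.neg (x.neg F)

/-- The term `s^x_{E/X}(X)`. -/
def SetSymbol.toFO {C : (target P S).Ctx} (x : Sem) (e : SetSymbol Con Var) (hS : e ∈ S)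
    (hC : Covers C e.params) : Term (target P S) C TSort.set :=
  Term.app (σ := target P S) (TFunc.setFn x e hS) (fun v : e.params => .var (genVar v.1) (hC v.1 v.2))

/-- The translation of a literal `B`, where `Z` is the set of global variables of the rule. -/
def Literal.toFO {C : (target P S).Ctx} (x : Sem) (Z : Finset Var) :
    (B : Literal Con Var) → B.preds ⊆ P → B.setSymbols Z ⊆ S → B.globalVars ⊆ Z → Covers C Z →
      Formula (target P S) C
  | .basic l, hP, _, hB, hC => l.sign.toFO x (l.form.toFO hP fun v hv => hC v (hB hv))
  | .agg sgn a, _, hS, hB, hC => sgn.toFO x (cmpFO a.cmp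
      (Term.app (σ := target P S) (TFunc.op a.op) fun _ : Unit =>
        (a.elem.setSymbol Z).toFO x (hS rfl) fun v hv => hC v (Finset.mem_inter.1 hv).2)
      (a.guard.toFO fun v hv => hC v (hB hv)))

def headToFO {C : (target P S).Ctx} :
    (h : Option (Atom Con (ProgTerm Con Var))) → (∀ a, h = some a → a.symbol ∈ P) →
      Covers C (headVars h) → Formula (target P S) C
  | none, _, _ => .bot
  | some a, hP, hC => a.toFO (hP a rfl) hC

/-- The translation of a rule: the universal closure of `B₁ ∧ ⋯ ∧ Bₙ → Head`. -/
noncomputable def Rule.toFO (x : Sem) (R : Rule Con Var) (hP : R.preds ⊆ P)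
    (hS : R.setSymbols ⊆ S) : Sentence (target P S) :=
  .alls (genCtx R.globalVars) (.imp
    (.conj (R.body.attach.map fun B => B.1.toFO x R.globalVars
      (fun _ hp => hP (Or.inr ⟨B.1, B.2, hp⟩))
      (fun _ he => hS ⟨B.1, B.2, he⟩)
      (fun _ hv => Finset.mem_union_right _ (mem_unionOver B.2 hv))
      (covers_genCtx_append _ _)))
    (headToFO R.head (fun a ha => hP (Or.inl ⟨a, ha, rfl⟩))
      (fun v hv => covers_genCtx_append _ _ v (Finset.mem_union_left _ hv))))

/-- The conjunction of the translations of the literals `l₁, …, lₘ` of an aggregate element. -/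
def AggElement.litsToFO {C : (target P S).Ctx} (x : Sem) (E : AggElement Con Var)
    (hP : E.preds ⊆ P) (hC : Covers C E.vars) : Formula (target P S) C :=
  .conj (E.lits.attach.map fun l => l.1.sign.toFO x (l.1.form.toFO
    (fun _ hp => hP ⟨l.1, l.2, hp⟩)
    (fun v hv => hC v (Finset.mem_union_right _ (mem_unionOver l.2 hv)))))

/-- The tuple term with arguments `t₁, …, tₖ`. -/
def AggElement.tupleToFO {C : (target P S).Ctx} (E : AggElement Con Var)
    (hS : ∃ e ∈ S, e.elem.terms.length = E.terms.length) (hC : Covers C E.vars) :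
    Term (target P S) C TSort.tuple :=
  Term.app (σ := target P S) (TFunc.tuple E.terms.length hS) (fun i : Fin E.terms.length =>
    (E.terms.get i).toFO fun v hv =>
      hC v (Finset.mem_union_left _ (mem_unionOver (E.terms.get_mem i) hv)))

/-! ### Standard interpretations and agg-interpretations -/

/-- The elements of the tuple universe. -/
abbrev TupleOf (S : Set (SetSymbol Con Var)) : Type :=
  {d : List (GroundTerm Con) // ∃ e ∈ S, e.elem.terms.length = d.length}

/-- The universes of standard interpretations: all ground terms; all tuples of ground terms of the
lengths determined by `S`; all sets of such tuples. -/
@[reducible]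
def StdU (S : Set (SetSymbol Con Var)) : TSort → Type
  | .gen => GroundTerm Con
  | .tuple => TupleOf S
  | .set => Set (TupleOf S)

variable (P S) in
/-- Interpretations of `σ(P, S)` with standard universes. -/
abbrev StdInterp : Type := Interp (target P S) (StdU S)

/-- The remaining conditions on standard interpretations. -/
structure IsStandard [TermOrder Con] (I : StdInterp P S) : Prop where
  const : ∀ (g : GroundTerm Con) (a), I.func (TFunc.const g) a = g
  cmp : ∀ (c : Cmp) (h : c ≠ .eq) (a : Fin 2 → GroundTerm Con),
    I.pred (TPred.cmp c h) a ↔ c.Rel (a 0) (a 1)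
  tuple : ∀ (k : ℕ) (h) (a : Fin k → GroundTerm Con),
    (I.func (TFunc.tuple k h) a : TupleOf S).1 = List.ofFn a
  mem : ∀ a : (∀ i : MemArg, StdU S (TPred.dom (P := P) TPred.mem i)),
    I.pred TPred.mem a ↔ Membership.mem (γ := Set (TupleOf S)) (a .right) (a .left)
  op : ∀ (o : Op) (a : Unit → Set (TupleOf S)),
    I.func (TFunc.op o) a = o.hat (Subtype.val '' a ())

/-- The assignment of values to program variables, as an assignment for the corresponding object
variables. -/
def genAssign (θ : Var → GroundTerm Con) (Z : Finset Var) :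
    Assign (σ := target P S) (StdU S) (genCtx Z) :=
  fun x h => match x, h with
    | ⟨.gen, v⟩, _ => θ v
    | ⟨.tuple, _⟩, h => absurd h (by simp [genCtx, genVar])
    | ⟨.set, _⟩, h => absurd h (by simp [genCtx, genVar])

theorem covers_genCtx (Z : Finset Var) : Covers (P := P) (S := S) (genCtx Z) Z := fun v hv =>
  List.mem_map.2 ⟨v, Finset.mem_toList.2 hv, rfl⟩

end Target

/-! ### Programs: translation, stable models, answer sets -/

section Programs

variable {Con Var : Type} [DecidableEq Var]

/-- The signature `σ(P, S)` where `P` and `S` consist of all predicate symbols and set symbols that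
occur in the program. -/
@[reducible]
def Program.sig (prog : Program Con Var) : Signature := target prog.preds prog.setSymbols

/-- The standard interpretations of the signature of a program are among these. -/
abbrev Program.Interp (prog : Program Con Var) : Type := StdInterp prog.preds prog.setSymbols

theorem Program.preds_of_setSymbol {prog : Program Con Var} {e : SetSymbol Con Var}
    (he : e ∈ prog.setSymbols) : e.elem.preds ⊆ prog.preds := by
  obtain ⟨R, hR, B, hB, h⟩ := he
  intro p hp
  refine ⟨R, hR, Or.inr ⟨B, hB, ?_⟩⟩
  cases B with
  | basic l => exact absurd h (Set.notMem_empty _)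
  | agg s a =>
    obtain rfl : e = a.elem.setSymbol R.globalVars := h
    exact hp

/-- The translation of a program into a theory. -/
def Program.toFO (x : Sem) (prog : Program Con Var) : Set (Sentence prog.sig) :=
  {F | ∃ (R : Rule Con Var) (hR : R ∈ prog),
    F = R.toFO x (Program.preds_subset hR) (Program.setSymbols_subset hR)}

/-- An object variable of the tuple sort. -/
def tupleVar {P : Set (PredSymbol Con)} {S : Set (SetSymbol Con Var)} :
    Σ s, (target P S).OVar s := ⟨TSort.tuple, (0 : ℕ)⟩

theorem SetSymbol.covers {P : Set (PredSymbol Con)} {S : Set (SetSymbol Con Var)}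
    (e : SetSymbol Con Var) :
    Covers (P := P) (S := S)
      (genCtx (e.elem.vars \ e.params) ++ tupleVar :: (genCtx e.params ++ [])) e.elem.vars :=
  fun v hv => by
    by_cases h : v ∈ e.params
    · exact List.mem_append_right _ (List.mem_cons_of_mem _ (covers_genCtx_append _ _ v h))
    · exact covers_genCtx_append _ _ v (Finset.mem_sdiff.2 ⟨hv, h⟩)

/-- The set comprehension axiom
`∀ X T (T ∈ s_{E/X}(X) ↔ ∃ Y (T = tuple(t₁, …, tₖ) ∧ l₁ ∧ ⋯ ∧ lₘ))` of the set symbol `E/X`,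
where `Y` consists of the variables of `E` not in `X`, and `T` is a variable of the tuple sort. -/
noncomputable def SetSymbol.comprehension {prog : Program Con Var} (e : SetSymbol Con Var)
    (he : e ∈ prog.setSymbols) : Sentence prog.sig :=
  .alls (genCtx e.params) (.all tupleVar (.iff
    (memFO (.var tupleVar List.mem_cons_self) (e.toFO .cli he fun v hv =>
      List.mem_cons_of_mem _ (covers_genCtx_append _ _ v hv)))
    (.exs (genCtx (e.elem.vars \ e.params)) (.and
      (.eq (.var tupleVar (List.mem_append_right _ List.mem_cons_self))
        (e.elem.tupleToFO ⟨e, he, rfl⟩ e.covers))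
      (e.elem.litsToFO .cli (Program.preds_of_setSymbol he) e.covers)))))

/-- The set comprehension axioms for the set symbols occurring in a program. -/
def Program.sca (prog : Program Con Var) : Set (Sentence prog.sig) :=
  {F | ∃ (e : SetSymbol Con Var) (he : e ∈ prog.setSymbols), F = e.comprehension he}

/-- The set of all tuples obtained from `t₁, …, tₖ` by a substitution `θ` of ground terms that
agrees with `a` on `X` and is such that `sat` holds for `l₁ ∧ ⋯ ∧ lₘ` under `θ`. -/
def SetSymbol.tuples {prog : Program Con Var} (e : SetSymbol Con Var)
    (he : e ∈ prog.setSymbols) (x : Sem) (a : e.params → GroundTerm Con)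
    (sat : Formula prog.sig (genCtx e.elem.vars) →
      Assign (σ := prog.sig) (StdU prog.setSymbols) (genCtx e.elem.vars) → Prop) :
    Set (TupleOf prog.setSymbols) :=
  {d | ∃ θ : Var → GroundTerm Con, (∀ v : e.params, θ v.1 = a v) ∧
    d.1 = e.elem.terms.map (ProgTerm.inst θ) ∧
    sat (e.elem.litsToFO x (Program.preds_of_setSymbol he) (covers_genCtx _)) (genAssign θ _)}

/-- Agg-interpretations. -/
def IsAggInterp [TermOrder Con] {prog : Program Con Var} (I : prog.Interp) : Prop :=
  IsStandard I ∧ ∀ (e : SetSymbol Con Var) (he : e ∈ prog.setSymbols) (x : Sem)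
    (a : e.params → GroundTerm Con),
    I.func (TFunc.setFn x e he) a = e.tuples he x a (fun F ρ => F.Sat I ρ)

variable {prog : Program Con Var}

/-- All program predicates are intensional. -/
def intPred (prog : Program Con Var) : Set prog.sig.Pred := {p | ∃ q h, p = TPred.user q h}

/-- All function constants corresponding to set symbols are intensional. -/
def intFunc (prog : Program Con Var) : Set prog.sig.Func := {f | ∃ x e h, f = TFunc.setFn x e h}

/-- `⟨H, I⟩` is an agg-ht-interpretation. -/
structure IsAggHT [TermOrder Con] (H I : prog.Interp) : Prop where
  le : HTLe (intPred prog) (intFunc prog) H I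
  standard_here : IsStandard H
  agg_there : IsAggInterp I
  cli : ∀ (e : SetSymbol Con Var) (he : e ∈ prog.setSymbols) (a : e.params → GroundTerm Con),
    H.func (TFunc.setFn .cli e he) a = e.tuples he .cli a (fun F ρ => F.HTSat H I ρ)
  dlv : ∀ (e : SetSymbol Con Var) (he : e ∈ prog.setSymbols) (a : e.params → GroundTerm Con),
    H.func (TFunc.setFn .dlv e he) a = e.tuples he .dlv a (fun F ρ => F.Sat H ρ)

/-- Agg-stable models of a set of sentences. -/
def IsAggStable [TermOrder Con] (I : prog.Interp) (Γ : Set (Sentence prog.sig)) : Prop :=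
  IsAggInterp I ∧ I.Models Γ ∧
  ¬ ∃ H : prog.Interp, IsAggHT H I ∧ HTModels H I Γ ∧ HTLt (intPred prog) (intFunc prog) H I

/-- The set of ground atoms `p(t₁, …, tₙ)` satisfied by an interpretation. -/
def groundAtoms (I : prog.Interp) : Set (GroundAtom Con) :=
  {A | ∃ h : A.symbol ∈ prog.preds,
    I.pred (TPred.user A.symbol h) (fun i : Fin A.args.length => A.args.get i)}

/-- The sets of ground atoms that correspond to the agg-stable models of `Γ`. -/
def foAnswerSets [TermOrder Con] (Γ : Set (Sentence prog.sig)) : Set (Set (GroundAtom Con)) :=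
  {A | ∃ I : prog.Interp, IsAggStable I Γ ∧ groundAtoms I = A}

end Programs

/-! ### Infinitary propositional formulas and the Abstract Gringo semantics -/

/-- Infinitary propositional formulas over the set `At` of atoms. Conjunctions and disjunctions of
sets of formulas are written as conjunctions and disjunctions of indexed families. -/
inductive InfFormula (At : Type) : Type 1
  | atom (A : At) : InfFormula At
  | conj {ι : Type} (F : ι → InfFormula At) : InfFormula At
  | disj {ι : Type} (F : ι → InfFormula At) : InfFormula At
  | imp (F G : InfFormula At) : InfFormula At

namespace InfFormula

variable {At : Type}

/-- `⊥` is the empty disjunction. -/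
def bot : InfFormula At := .disj (fun i : Empty => nomatch i)

/-- `⊤` is the empty conjunction. -/
def top : InfFormula At := .conj (fun i : Empty => nomatch i)

def neg (F : InfFormula At) : InfFormula At := .imp F bot

/-- The conjunction of a list of formulas. -/
def conjList (l : List (InfFormula At)) : InfFormula At := .conj (fun i : Fin l.length => l.get i)

/-- Satisfaction of a formula by a set of atoms. -/
def Sat (X : Set At) : InfFormula At → Prop
  | atom A => A ∈ X
  | conj F => ∀ i, (F i).Sat X
  | disj F => ∃ i, (F i).Sat X
  | imp F G => F.Sat X → G.Sat X

open Classical in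
/-- The FT-reduct of a formula with respect to a set of atoms. -/
noncomputable def reduct (X : Set At) : InfFormula At → InfFormula At
  | atom A => if A ∈ X then atom A else bot
  | conj F => conj fun i => (F i).reduct X
  | disj F => disj fun i => (F i).reduct X
  | imp F G => if (imp F G).Sat X then imp (F.reduct X) (G.reduct X) else bot

/-- `X` is a minimal model of `F` with respect to set inclusion. -/
def IsMinimalModel (X : Set At) (F : InfFormula At) : Prop :=
  F.Sat X ∧ ¬ ∃ Y : Set At, F.Sat Y ∧ Y ⊂ X

/-- `X` is an FT-stable model of `F`. -/
def IsFTStable (X : Set At) (F : InfFormula At) : Prop := IsMinimalModel X (F.reduct X)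

end InfFormula

section Tau

variable {Con Var : Type} [TermOrder Con]

def Sign.tau {At : Type} (sgn : Sign) (F : InfFormula At) : InfFormula At :=
  match sgn with
  | .pos => F
  | .not => F.neg
  | .notNot => F.neg.neg

open Classical in
/-- `τ` of the instance of an atomic formula under the substitution `θ`. -/
noncomputable def AtomicFormula.tau (θ : Var → GroundTerm Con) :
    AtomicFormula Con Var → InfFormula (GroundAtom Con)
  | .atom a => .atom (a.inst θ)
  | .cmp c s t => if c.Rel (s.inst θ) (t.inst θ) then .top else .bot

noncomputable def BasicLiteral.tau (θ : Var → GroundTerm Con) (l : BasicLiteral Con Var) :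
    InfFormula (GroundAtom Con) :=
  l.sign.tau (l.form.tau θ)

/-- `τ` of the conjunction of the literals of an aggregate element under `θ`. -/
noncomputable def AggElement.tau (θ : Var → GroundTerm Con) (E : AggElement Con Var) :
    InfFormula (GroundAtom Con) :=
  .conjList (E.lits.map (BasicLiteral.tau θ))

variable [DecidableEq Var]

/-- The substitution that maps the variables in `Y` according to `y`, and all others according
to `θ`. -/
def override (θ : Var → GroundTerm Con) {Y : Finset Var} (y : Y → GroundTerm Con) :
    Var → GroundTerm Con :=
  fun v => if h : v ∈ Y then y ⟨v, h⟩ else θ v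

/-- The variables of the aggregate element that are local when the variables in `Z` are global. -/
def AggAtom.localVars (Z : Finset Var) (a : AggAtom Con Var) : Finset Var := a.elem.vars \ Z

/-- The set `Δ` of tuples of values of the local variables justifies the instance of the aggregate
atom in which the global variables (those in `Z`) are replaced according to `θ`. -/
def AggAtom.Justifies (Z : Finset Var) (θ : Var → GroundTerm Con) (a : AggAtom Con Var)
    (Δ : Set (a.localVars Z → GroundTerm Con)) : Prop :=
  a.cmp.Rel
    (a.op.hat ((fun y => a.elem.terms.map (ProgTerm.inst (override θ y))) '' Δ))
    (a.guard.inst θ)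

/-- `τ` of an instance of an aggregate atom: the conjunction, over all sets `Δ` that do not justify
it, of the implications `⋀_{y ∈ Δ} l_y → ⋁_{y ∉ Δ} l_y`. -/
noncomputable def AggAtom.tau (Z : Finset Var) (θ : Var → GroundTerm Con) (a : AggAtom Con Var) :
    InfFormula (GroundAtom Con) :=
  .conj fun Δ : {Δ : Set (a.localVars Z → GroundTerm Con) // ¬ a.Justifies Z θ Δ} =>
    .imp (.conj fun y : Δ.1 => a.elem.tau (override θ y.1))
      (.disj fun y : (Δ.1ᶜ : Set (a.localVars Z → GroundTerm Con)) =>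
        a.elem.tau (override θ y.1))

noncomputable def Literal.tau (Z : Finset Var) (θ : Var → GroundTerm Con) :
    Literal Con Var → InfFormula (GroundAtom Con)
  | .basic l => l.tau θ
  | .agg sgn a => sgn.tau (a.tau Z θ)

def headTau (θ : Var → GroundTerm Con) :
    Option (Atom Con (ProgTerm Con Var)) → InfFormula (GroundAtom Con)
  | none => .bot
  | some a => .atom (a.inst θ)

/-- `τ` of a rule: the conjunction of the translations of all its instances. Variables that are not
global are handled in the translation of aggregate atoms, and the value given to them by the
default `inf` is never used. -/
noncomputable def Rule.tau (R : Rule Con Var) : InfFormula (GroundAtom Con) :=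
  .conj fun z : R.globalVars → GroundTerm Con =>
    let θ := override (fun _ => GroundTerm.inf) z
    .imp (.conjList (R.body.map (Literal.tau R.globalVars θ))) (headTau θ R.head)

/-- `τ` of a program. -/
noncomputable def Program.tau (prog : Program Con Var) : InfFormula (GroundAtom Con) :=
  .conj fun R : prog => R.1.tau

/-- The gringo answer sets of a program: the FT-stable models of its translation `τ`. -/
def gringoAnswerSets (prog : Program Con Var) : Set (Set (GroundAtom Con)) :=
  {A | InfFormula.IsFTStable A prog.tau}

end Tau

end AspAgg

/-! Both sides are notions of equilibrium in the logic of here-and-there, and they are compared pair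
by pair. On the propositional side, `Y` satisfies the reduct of `F` with respect to `X` iff `⟨Y, X⟩`
satisfies `F` in here-and-there (`InfFormula.sat_reduct`). So answer sets are the models `X` of `τΠ`
for which no `⟨Y, X⟩` with `Y ⊂ X` satisfies `τΠ`.

On the first-order side, an agg-ht-interpretation `⟨H, I⟩` is determined by the ground atoms of `H`
and `I`. The remaining non-intensional symbols are fixed by standardness, and the set functions are
computed from the truth of basic literals, which depends on ground atoms only. Conversely, every
subset of the atoms of `I` is the set of atoms of some `H` (up to foreign predicate symbols), by
`isAggHT_stdInterp`. Equal atoms force `H = I` (`IsAggHT.eq_of_groundAtoms_eq`), so `H ≺ I` matches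
proper inclusion.

It remains to see that corresponding pairs satisfy `τ^cli Π` and `τΠ` simultaneously
(`Program.htModels_toFO`). The crux is an aggregate atom. By `AggAtom.htSat_tau`, its infinitary
translation holds in `⟨Y, X⟩` iff two sets justify it: the instances true in `X`, and the instances
true in `⟨Y, X⟩`. The tuples produced by these are the values of the `cli` set function in `I` and
in `H`, so both translations impose the same two conditions.

The axioms SCA hold in every agg-ht-interpretation, so adding them changes nothing. -/

namespace AspAgg

/-! ### The logic of here-and-there for infinitary formulas -/

namespace InfFormula

variable {At : Type}

/-- Satisfaction of an infinitary formula in the pair `⟨Y, X⟩`. -/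
def HTSat (Y X : Set At) : InfFormula At → Prop
  | atom A => A ∈ X ∧ A ∈ Y
  | conj F => ∀ i, (F i).HTSat Y X
  | disj F => ∃ i, (F i).HTSat Y X
  | imp F G => (F.Sat X → G.Sat X) ∧ (F.HTSat Y X → G.HTSat Y X)

theorem sat_bot (X : Set At) : ¬ (bot : InfFormula At).Sat X := fun h => h.choose.elim

theorem htSat_bot (Y X : Set At) : ¬ (bot : InfFormula At).HTSat Y X := fun h => h.choose.elim

theorem htSat_top (Y X : Set At) : (top : InfFormula At).HTSat Y X := fun i => nomatch i

/-- The reduct puts `⊥` for atoms outside `X` and for implications false in `X`, exactly where the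
conjunct about `X` in `HTSat` fails. As the atomic clause tests both sets, `Y ⊆ X` is not needed. -/
theorem sat_reduct (Y X : Set At) (F : InfFormula At) :
    (F.reduct X).Sat Y ↔ F.HTSat Y X := by
  induction F with
  | atom A =>
    by_cases h : A ∈ X
    · simp [reduct, HTSat, Sat, h]
    · simp [reduct, HTSat, h, sat_bot]
  | conj F ih => exact forall_congr' ih
  | disj F ih => exact exists_congr ih
  | imp F G ihF ihG =>
    by_cases h : (imp F G).Sat X
    · have h' : F.Sat X → G.Sat X := h
      rw [reduct, if_pos h]
      exact ⟨fun k => ⟨h', fun hF => ihG.1 (k (ihF.2 hF))⟩,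
        fun k hF => ihG.2 (k.2 (ihF.1 hF))⟩
    · have h' : ¬ (F.Sat X → G.Sat X) := h
      simp only [reduct, h, if_false, HTSat, h', false_and, sat_bot]

/-- Together with `Formula.htSat_self`, this makes each classical correspondence the diagonal case
of the here-and-there one. -/
theorem htSat_self (X : Set At) (F : InfFormula At) : F.HTSat X X ↔ F.Sat X := by
  induction F with
  | atom A => exact and_self_iff
  | conj F ih => exact forall_congr' ih
  | disj F ih => exact exists_congr ih
  | imp F G ihF ihG => simp only [HTSat, Sat, ihF, ihG, and_self]

theorem htSat_conjList (Y X : Set At) (l : List (InfFormula At)) :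
    (conjList l).HTSat Y X ↔ ∀ F ∈ l, F.HTSat Y X :=
  List.forall_mem_iff_get.symm

theorem isFTStable_iff (X : Set At) (F : InfFormula At) :
    IsFTStable X F ↔ F.Sat X ∧ ∀ Y ⊂ X, ¬ F.HTSat Y X := by
  simp only [IsFTStable, IsMinimalModel, sat_reduct, htSat_self]
  refine and_congr_right fun _ => ?_
  constructor
  · exact fun h Y hY hF => h ⟨Y, hF, hY⟩
  · rintro h ⟨Y, hF, hY⟩
    exact h Y hY hF

end InfFormula

/-! ### Satisfaction of first-order formulas -/

section Logic

variable {σ : Signature} {U : σ.Srt → Type}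

theorem Formula.htSat_self (I : Interp σ U) {C : σ.Ctx} (F : Formula σ C) (ρ : Assign U C) :
    F.HTSat I I ρ ↔ F.Sat I ρ := by
  induction F with
  | bot => exact Iff.rfl
  | pred p ts => exact and_self_iff
  | eq t₁ t₂ => exact and_self_iff
  | sneg F ih => exact and_self_iff
  | and F G ihF ihG => exact and_congr (ihF ρ) (ihG ρ)
  | or F G ihF ihG => exact or_congr (ihF ρ) (ihG ρ)
  | imp F G ihF ihG =>
    simp only [HTSat, Sat, ihF, ihG]
    tauto
  | all x F ih => exact forall_congr' fun d => ih _
  | ex x F ih => exact exists_congr fun d => ih _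

/-- Atomic formulas, `sneg` and implications carry their truth in `I` as a conjunct, so persistence
does not depend on `H ≼ I`. -/
theorem Formula.HTSat.sat {H I : Interp σ U} {C : σ.Ctx} {F : Formula σ C} {ρ : Assign U C}
    (h : F.HTSat H I ρ) : F.Sat I ρ := by
  induction F with
  | bot => exact h
  | pred p ts => exact h.1
  | eq t₁ t₂ => exact h.1
  | sneg F ih => exact h.1
  | and F G ihF ihG => exact ⟨ihF h.1, ihG h.2⟩
  | or F G ihF ihG => exact h.imp ihF ihG
  | imp F G ihF ihG => exact h.1
  | all x F ih => exact fun d => ih (h d)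
  | ex x F ih => exact h.imp fun d hd => ih hd

theorem Formula.htSat_imp_of_sat {H I : Interp σ U} {C : σ.Ctx} {F G : Formula σ C}
    {ρ : Assign U C} (h : F.Sat I ρ → G.Sat I ρ) :
    (F.imp G).HTSat H I ρ ↔ (F.HTSat H I ρ → G.HTSat H I ρ) := by
  exact (and_iff_right h).trans imp_iff_not_or.symm

theorem Formula.sat_conj (I : Interp σ U) {C : σ.Ctx} (l : List (Formula σ C)) (ρ : Assign U C) :
    (conj l).Sat I ρ ↔ ∀ F ∈ l, F.Sat I ρ := by
  induction l with
  | nil => simp [conj, top, neg, Sat]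
  | cons F l ih => rw [List.forall_mem_cons, ← ih]; rfl

theorem Formula.htSat_conj (H I : Interp σ U) {C : σ.Ctx} (l : List (Formula σ C))
    (ρ : Assign U C) : (conj l).HTSat H I ρ ↔ ∀ F ∈ l, F.HTSat H I ρ := by
  induction l with
  | nil => simp [conj, top, neg, Sat, HTSat]
  | cons F l ih => rw [List.forall_mem_cons, ← ih]; rfl

/-! ### Assignments and blocks of quantifiers. -/

theorem Assign.cons_self {C : σ.Ctx} (ρ : Assign U C) (x : Σ s, σ.OVar s) (d : U x.1)
    (h : x ∈ x :: C) : ρ.cons x d x h = d := by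
  simp [Assign.cons]

theorem Assign.cons_of_ne {C : σ.Ctx} (ρ : Assign U C) {x y : Σ s, σ.OVar s} (d : U x.1)
    (hne : y ≠ x) (h : y ∈ x :: C) :
    ρ.cons x d y h = ρ y ((List.mem_cons.1 h).resolve_left hne) := by
  simp [Assign.cons, hne]

/-- `ρ'` agrees with `ρ` on the variables that do not belong to `L`. -/
def Assign.Extends {C : σ.Ctx} {L : σ.Ctx} (ρ' : Assign U (L ++ C)) (ρ : Assign U C) : Prop :=
  ∀ x (hx : x ∈ C), x ∉ L → ρ' x (List.mem_append_right L hx) = ρ x hx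

theorem Assign.extends_nil {C : σ.Ctx} {ρ ρ' : Assign U C} :
    Assign.Extends (L := []) ρ' ρ ↔ ρ' = ρ :=
  ⟨fun h => funext fun x => funext fun hx => h x hx List.not_mem_nil, fun h => by subst h; intro x hx _; rfl⟩

theorem Assign.Extends.cons {C : σ.Ctx} {L : σ.Ctx} {ρ' : Assign U (L ++ C)} {ρ : Assign U C}
    (h : ρ'.Extends ρ) (x : Σ s, σ.OVar s) (d : U x.1) :
    Assign.Extends (L := x :: L) (ρ'.cons x d) ρ := by
  intro y hy hyL
  rw [List.mem_cons, not_or] at hyL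
  rw [Assign.cons_of_ne _ _ hyL.1]
  exact h y hy hyL.2

theorem Assign.Extends.exists_cons {C : σ.Ctx} {x : Σ s, σ.OVar s} {L : σ.Ctx}
    {ρ' : Assign U (x :: (L ++ C))} {ρ : Assign U C}
    (h : Assign.Extends (L := x :: L) ρ' ρ) :
    ∃ (ρ₁ : Assign U (L ++ C)) (d : U x.1), ρ₁.Extends ρ ∧ ρ' = ρ₁.cons x d := by
  classical
  -- Outside `L` the values come from `ρ`, not from `ρ'`: if `x` also occurs in `C`, then `ρ'` may
  -- give it another value, and its restriction would not extend `ρ`.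
  refine ⟨fun y hy => if hL : y ∈ L then ρ' y (List.mem_cons_of_mem _ hy) else
    ρ y ((List.mem_append.1 hy).resolve_left hL), ρ' x List.mem_cons_self, ?_, ?_⟩
  · intro y hy hyL
    simp [hyL]
  · funext y hy
    by_cases hyx : y = x
    · subst hyx
      rw [Assign.cons_self]
    · rw [Assign.cons_of_ne _ _ hyx]
      split_ifs with hL
      · rfl
      · have hyC : y ∈ C := by
          have := (List.mem_cons.1 hy).resolve_left hyx
          exact (List.mem_append.1 this).resolve_left hL
        exact h y hyC (by simp [hyx, hL])

/-- The head of the list is the innermost quantifier, so its value is added last and overrides any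
earlier value of the same variable. -/
theorem Formula.htSat_alls (H I : Interp σ U) {C : σ.Ctx} (L : σ.Ctx) (F : Formula σ (L ++ C))
    (ρ : Assign U C) :
    (alls L F).HTSat H I ρ ↔ ∀ ρ' : Assign U (L ++ C), ρ'.Extends ρ → F.HTSat H I ρ' := by
  induction L with
  | nil =>
    constructor
    · intro h ρ' hρ
      obtain rfl := Assign.extends_nil.1 hρ
      exact h
    · exact fun h => h ρ (Assign.extends_nil.2 rfl)
  | cons x L ih =>
    refine (ih (.all x F)).trans ⟨fun h ρ' hρ => ?_, fun h ρ₁ hρ d => h _ (hρ.cons x d)⟩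
    obtain ⟨ρ₁, d, h₁, rfl⟩ := hρ.exists_cons
    exact h ρ₁ h₁ d

theorem Formula.htSat_exs (H I : Interp σ U) {C : σ.Ctx} (L : σ.Ctx) (F : Formula σ (L ++ C))
    (ρ : Assign U C) :
    (exs L F).HTSat H I ρ ↔ ∃ ρ' : Assign U (L ++ C), ρ'.Extends ρ ∧ F.HTSat H I ρ' := by
  induction L with
  | nil =>
    constructor
    · exact fun h => ⟨ρ, Assign.extends_nil.2 rfl, h⟩
    · rintro ⟨ρ', hρ, h⟩
      obtain rfl := Assign.extends_nil.1 hρ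
      exact h
  | cons x L ih =>
    refine (ih (.ex x F)).trans ⟨?_, ?_⟩
    · rintro ⟨ρ₁, hρ, d, h⟩
      exact ⟨_, hρ.cons x d, h⟩
    · rintro ⟨ρ', hρ, h⟩
      obtain ⟨ρ₁, d, h₁, rfl⟩ := hρ.exists_cons
      exact ⟨ρ₁, h₁, d, h⟩

end Logic

/-! ### First-order translations of basic literals -/

theorem ofFn_eq_map_of_get {α β : Type*} {l : List α} {f : α → β} {g : Fin l.length → β}
    (h : ∀ i, g i = f (l.get i)) : List.ofFn g = l.map f := by
  rw [funext h]
  exact List.map_ofFn.symm.trans (congrArg (List.map f) (List.ofFn_get l))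

section Basic

variable {Con Var : Type} [DecidableEq Var] {P : Set (PredSymbol Con)}
  {S : Set (SetSymbol Con Var)}

/-- The values of the general variables under `ρ` are given by `θ`. -/
def Agrees {C : (target P S).Ctx} (ρ : Assign (σ := target P S) (StdU S) C)
    (θ : Var → GroundTerm Con) : Prop :=
  ∀ (v : Var) (h : genVar v ∈ C), ρ (genVar v) h = θ v

theorem genVar_mem_genCtx {Z : Finset Var} {v : Var} :
    (genVar v : Σ s, (target P S).OVar s) ∈ genCtx Z ↔ v ∈ Z := by
  constructor
  · intro h
    obtain ⟨w, hw, h⟩ := List.mem_map.1 h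
    have : w = v := by
      simpa [genVar] using h
    exact this ▸ Finset.mem_toList.1 hw
  · exact fun h => covers_genCtx Z v h

theorem tupleVar_notMem_genCtx {Z : Finset Var} :
    (tupleVar : Σ s, (target P S).OVar s) ∉ genCtx Z := by
  simp [genCtx, genVar, tupleVar]

theorem genVar_ne_tupleVar {v : Var} :
    (genVar v : Σ s, (target P S).OVar s) ≠ tupleVar := by
  simp [genVar, tupleVar]

theorem genAssign_agrees (Z : Finset Var) {θ θ' : Var → GroundTerm Con}
    (h : ∀ v ∈ Z, θ v = θ' v) : Agrees (P := P) (S := S) (genAssign θ Z) θ' :=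
  fun v hv => h v (genVar_mem_genCtx.1 hv)

/-- The user-defined predicates of `I` are given by the set `X` of ground atoms. -/
def Represents (I : StdInterp P S) (X : Set (GroundAtom Con)) : Prop :=
  ∀ (q : PredSymbol Con) (h : q ∈ P) (a : Fin q.2 → GroundTerm Con),
    I.pred (TPred.user q h) a ↔ (⟨q.1, List.ofFn a⟩ : GroundAtom Con) ∈ X

/-- Here-and-there negation also inspects its argument classically in the there-world, so passing
through `not` takes both equivalences as input. -/
theorem Sign.htSat_toFO {H I : StdInterp P S} {Y X : Set (GroundAtom Con)}
    {C : (target P S).Ctx} {ρ : Assign (σ := target P S) (StdU S) C} {F : Formula (target P S) C}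
    {G : InfFormula (GroundAtom Con)} (sgn : Sign) (h : F.Sat I ρ ↔ G.Sat X)
    (hHT : F.HTSat H I ρ ↔ G.HTSat Y X) :
    (sgn.toFO .cli F).HTSat H I ρ ↔ (sgn.tau G).HTSat Y X := by
  have hb := InfFormula.sat_bot X
  have hb' := InfFormula.htSat_bot Y X
  cases sgn <;>
    simp only [Sign.toFO, Sign.tau, Sem.neg, Formula.neg, InfFormula.neg, Formula.HTSat,
      Formula.Sat, InfFormula.HTSat, InfFormula.Sat, h, hHT, hb, hb'] <;> tauto

variable [TermOrder Con]

theorem ProgTerm.eval_toFO {I : StdInterp P S} (hI : IsStandard I) {C : (target P S).Ctx}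
    {ρ : Assign (σ := target P S) (StdU S) C} {θ : Var → GroundTerm Con} (hρ : Agrees ρ θ)
    (t : ProgTerm Con Var) (hC : Covers C t.vars) :
    (t.toFO hC).eval I ρ = t.inst θ := by
  cases t with
  | ground g => exact hI.const g _
  | var v => exact hρ v _

/-- Values in `H` and `I` are kept apart because an aggregate term may evaluate differently in the
two worlds. -/
theorem htSat_cmpFO {H I : StdInterp P S} (hH : IsStandard H) (hI : IsStandard I)
    {C : (target P S).Ctx} {ρ : Assign (σ := target P S) (StdU S) C} (c : Cmp)
    {s t : Term (target P S) C TSort.gen} {s₁ t₁ s₂ t₂ : GroundTerm Con}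
    (hs₁ : s.eval I ρ = s₁) (ht₁ : t.eval I ρ = t₁) (hs₂ : s.eval H ρ = s₂)
    (ht₂ : t.eval H ρ = t₂) :
    (cmpFO c s t).HTSat H I ρ ↔ c.Rel s₁ t₁ ∧ c.Rel s₂ t₂ := by
  subst hs₁ ht₁ hs₂ ht₂
  unfold cmpFO
  split_ifs with h
  · subst h
    exact Iff.rfl
  · exact and_congr (hI.cmp c h _) (hH.cmp c h _)

theorem Atom.pred_toFO {I : StdInterp P S} {X : Set (GroundAtom Con)} (hI : IsStandard I)
    (hX : Represents I X) {C : (target P S).Ctx} {ρ : Assign (σ := target P S) (StdU S) C}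
    {θ : Var → GroundTerm Con} (hρ : Agrees ρ θ) (a : Atom Con (ProgTerm Con Var))
    (hP : a.symbol ∈ P) (hC : Covers C (unionOver ProgTerm.vars a.args)) :
    (a.toFO hP hC).Sat I ρ ↔ a.inst θ ∈ X := by
  refine (hX a.symbol hP _).trans ?_
  exact iff_of_eq (congrArg (fun l => (⟨a.pred, l⟩ : GroundAtom Con) ∈ X)
    (ofFn_eq_map_of_get fun i => ProgTerm.eval_toFO hI hρ _ _))

theorem Atom.htSat_toFO {H I : StdInterp P S} {Y X : Set (GroundAtom Con)} (hH : IsStandard H)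
    (hI : IsStandard I) (hY : Represents H Y) (hX : Represents I X) {C : (target P S).Ctx}
    {ρ : Assign (σ := target P S) (StdU S) C} {θ : Var → GroundTerm Con} (hρ : Agrees ρ θ)
    (a : Atom Con (ProgTerm Con Var)) (hP : a.symbol ∈ P)
    (hC : Covers C (unionOver ProgTerm.vars a.args)) :
    (a.toFO hP hC).HTSat H I ρ ↔ a.inst θ ∈ X ∧ a.inst θ ∈ Y :=
  and_congr (a.pred_toFO hI hX hρ hP hC) (a.pred_toFO hH hY hρ hP hC)

theorem AtomicFormula.htSat_toFO {H I : StdInterp P S} {Y X : Set (GroundAtom Con)}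
    (hH : IsStandard H) (hI : IsStandard I) (hY : Represents H Y) (hX : Represents I X)
    {C : (target P S).Ctx} {ρ : Assign (σ := target P S) (StdU S) C}
    {θ : Var → GroundTerm Con} (hρ : Agrees ρ θ) (A : AtomicFormula Con Var) (hP : A.preds ⊆ P)
    (hC : Covers C A.vars) :
    (A.toFO hP hC).HTSat H I ρ ↔ (A.tau θ).HTSat Y X := by
  cases A with
  | atom a => exact a.htSat_toFO hH hI hY hX hρ _ hC
  | cmp c s t =>
    refine (htSat_cmpFO hH hI c (ProgTerm.eval_toFO hI hρ _ _) (ProgTerm.eval_toFO hI hρ _ _)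
      (ProgTerm.eval_toFO hH hρ _ _) (ProgTerm.eval_toFO hH hρ _ _)).trans ?_
    rw [and_self, tau]
    split_ifs with h
    · simp [h, InfFormula.htSat_top]
    · simp [h, InfFormula.htSat_bot]

theorem Sign.sat_toFO_dlv {σ : Signature} {U : σ.Srt → Type} (I : Interp σ U) {C : σ.Ctx}
    (ρ : Assign U C) (F : Formula σ C) (sgn : Sign) :
    (sgn.toFO .dlv F).Sat I ρ ↔ (sgn.toFO .cli F).Sat I ρ := by
  cases sgn <;> exact Iff.rfl

theorem BasicLiteral.htSat_toFO {H I : StdInterp P S} {Y X : Set (GroundAtom Con)}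
    (hH : IsStandard H) (hI : IsStandard I) (hY : Represents H Y) (hX : Represents I X)
    {C : (target P S).Ctx} {ρ : Assign (σ := target P S) (StdU S) C}
    {θ : Var → GroundTerm Con} (hρ : Agrees ρ θ) (l : BasicLiteral Con Var)
    (hP : l.form.preds ⊆ P) (hC : Covers C l.form.vars) :
    (l.sign.toFO .cli (l.form.toFO hP hC)).HTSat H I ρ ↔ (l.tau θ).HTSat Y X := by
  refine l.sign.htSat_toFO ?_ (l.form.htSat_toFO hH hI hY hX hρ hP hC)
  rw [← Formula.htSat_self, ← InfFormula.htSat_self]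
  exact l.form.htSat_toFO hI hI hX hX hρ hP hC

theorem AggElement.htSat_litsToFO {H I : StdInterp P S} {Y X : Set (GroundAtom Con)}
    (hH : IsStandard H) (hI : IsStandard I) (hY : Represents H Y) (hX : Represents I X)
    {C : (target P S).Ctx} {ρ : Assign (σ := target P S) (StdU S) C}
    {θ : Var → GroundTerm Con} (hρ : Agrees ρ θ) (E : AggElement Con Var)
    (hP : E.preds ⊆ P) (hC : Covers C E.vars) :
    (E.litsToFO .cli hP hC).HTSat H I ρ ↔ (E.tau θ).HTSat Y X := by
  unfold AggElement.litsToFO AggElement.tau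
  rw [Formula.htSat_conj, InfFormula.htSat_conjList, List.forall_mem_map, List.forall_mem_map]
  constructor
  · exact fun h l hl => (l.htSat_toFO hH hI hY hX hρ _ _).1 (h ⟨l, hl⟩ (List.mem_attach _ _))
  · exact fun h l _ => (l.1.htSat_toFO hH hI hY hX hρ _ _).2 (h l.1 l.2)

/-- Classically the two negations coincide, so `dlv` reduces to `cli`. -/
theorem AggElement.sat_litsToFO {I : StdInterp P S} {X : Set (GroundAtom Con)}
    (hI : IsStandard I) (hX : Represents I X) {C : (target P S).Ctx}
    {ρ : Assign (σ := target P S) (StdU S) C} {θ : Var → GroundTerm Con} (hρ : Agrees ρ θ)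
    (E : AggElement Con Var) (x : Sem) (hP : E.preds ⊆ P) (hC : Covers C E.vars) :
    (E.litsToFO x hP hC).Sat I ρ ↔ (E.tau θ).Sat X := by
  have hcli := E.htSat_litsToFO hI hI hX hX hρ hP hC
  rw [Formula.htSat_self, InfFormula.htSat_self] at hcli
  rw [← hcli]
  cases x with
  | cli => exact Iff.rfl
  | dlv =>
    unfold AggElement.litsToFO
    simp only [Formula.sat_conj, List.forall_mem_map, Sign.sat_toFO_dlv]

theorem AggElement.eval_tupleToFO {I : StdInterp P S} (hI : IsStandard I)
    {C : (target P S).Ctx} {ρ : Assign (σ := target P S) (StdU S) C}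
    {θ : Var → GroundTerm Con} (hρ : Agrees ρ θ) (E : AggElement Con Var)
    (hS : ∃ e ∈ S, e.elem.terms.length = E.terms.length) (hC : Covers C E.vars) :
    ((E.tupleToFO hS hC).eval I ρ : TupleOf S).1 = E.terms.map (ProgTerm.inst θ) := by
  exact (hI.tuple _ hS _).trans
    (ofFn_eq_map_of_get fun i => ProgTerm.eval_toFO hI hρ _ _)

end Basic

/-! ### Dependence of translations on substitutions -/

section Congr

variable {Con Var : Type} {θ θ' : Var → GroundTerm Con}

theorem ProgTerm.inst_congr {t : ProgTerm Con Var} (h : ∀ v ∈ t.vars, θ v = θ' v) :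
    t.inst θ = t.inst θ' := by
  cases t with
  | ground g => rfl
  | var v => exact h v (Finset.mem_singleton_self v)

variable [DecidableEq Var]

theorem map_inst_congr {l : List (ProgTerm Con Var)}
    (h : ∀ v ∈ unionOver ProgTerm.vars l, θ v = θ' v) :
    l.map (ProgTerm.inst θ) = l.map (ProgTerm.inst θ') :=
  List.map_congr_left fun _ ht => ProgTerm.inst_congr fun v hv => h v (mem_unionOver ht hv)

/-- Used to replace an arbitrary substitution that agrees on the global variables by one of the form
`override θ y`. -/
theorem AggElement.tau_congr [TermOrder Con] {E : AggElement Con Var}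
    (h : ∀ v ∈ E.vars, θ v = θ' v) : E.tau θ = E.tau θ' := by
  refine congrArg InfFormula.conjList (List.map_congr_left fun l hl => ?_)
  have hl' : ∀ v ∈ l.form.vars, θ v = θ' v := fun v hv =>
    h v (Finset.mem_union_right _ (mem_unionOver hl hv))
  refine congrArg l.sign.tau ?_
  revert hl'
  cases l.form with
  | atom a =>
    intro h
    simp only [AtomicFormula.tau, Atom.inst, map_inst_congr h]
  | cmp c s t =>
    intro h
    simp only [AtomicFormula.tau]
    rw [ProgTerm.inst_congr fun v hv => h v (Finset.mem_union_left _ hv),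
      ProgTerm.inst_congr (t := t) fun v hv => h v (Finset.mem_union_right _ hv)]

end Congr

/-! ### Here-and-there satisfaction of aggregate atoms -/

section Aggregates

variable {Con Var : Type} [DecidableEq Var] [TermOrder Con]

/-- Let `T` be the set of `y` for which `l_y` is true. The implication indexed by `Δ` fails iff `Δ ⊆
T` and `T ⊆ Δ`, so the conjunction over non-justifying `Δ` says that `T` justifies the atom. A
here-and-there implication is checked once classically in `X` and once in `⟨Y, X⟩`, which gives one
such condition for each notion of truth. -/
theorem AggAtom.htSat_tau (Z : Finset Var) (θ : Var → GroundTerm Con) (a : AggAtom Con Var)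
    (Y X : Set (GroundAtom Con)) :
    (a.tau Z θ).HTSat Y X ↔
      a.Justifies Z θ {y | (a.elem.tau (override θ y)).Sat X} ∧
      a.Justifies Z θ {y | (a.elem.tau (override θ y)).HTSat Y X} := by
  constructor
  · intro h
    constructor
    -- Otherwise the truth set indexes a conjunct itself. Its antecedent holds, so some instance
    -- outside the truth set would be true.
    · by_contra hΔ
      obtain ⟨y, hy⟩ := (h ⟨_, hΔ⟩).1 fun y => y.2
      exact y.2 hy
    · by_contra hΔ
      obtain ⟨y, hy⟩ := (h ⟨_, hΔ⟩).2 fun y => y.2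
      exact y.2 hy
  · rintro ⟨h₁, h₂⟩ ⟨Δ, hΔ⟩
    constructor
    · intro h
      -- A true antecedent with a false consequent makes `Δ` equal to the truth set, which justifies
      -- the atom.
      by_contra hn
      refine hΔ (?_ : a.Justifies Z θ Δ)
      convert h₁ using 1
      ext y
      refine ⟨fun hy => h ⟨y, hy⟩, fun hy => ?_⟩
      by_contra hyΔ
      exact hn ⟨⟨y, hyΔ⟩, hy⟩
    · intro h
      by_contra hn
      refine hΔ (?_ : a.Justifies Z θ Δ)
      convert h₂ using 1
      ext y
      refine ⟨fun hy => h ⟨y, hy⟩, fun hy => ?_⟩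
      by_contra hyΔ
      exact hn ⟨⟨y, hyΔ⟩, hy⟩

/-- The tuples obtained from `t₁, …, tₖ` by a substitution that agrees with `a` on `X` and is such
that `sat` holds for the propositional translation of `l₁ ∧ ⋯ ∧ lₘ`. -/
def SetSymbol.tauTuples (S : Set (SetSymbol Con Var)) (e : SetSymbol Con Var)
    (a : e.params → GroundTerm Con) (sat : InfFormula (GroundAtom Con) → Prop) :
    Set (TupleOf S) :=
  {d | ∃ θ : Var → GroundTerm Con, (∀ v : e.params, θ v.1 = a v) ∧
    d.1 = e.elem.terms.map (ProgTerm.inst θ) ∧ sat (e.elem.tau θ)}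

/-- On the left whole substitutions vary, on the right only the values of local variables. The
tuples are the same because every variable of the element is either local or in `X`. -/
theorem AggAtom.image_tauTuples {S : Set (SetSymbol Con Var)} (Z : Finset Var)
    (θ : Var → GroundTerm Con) (a : AggAtom Con Var) (hS : a.elem.setSymbol Z ∈ S)
    (sat : InfFormula (GroundAtom Con) → Prop) :
    Subtype.val '' (a.elem.setSymbol Z).tauTuples S (fun v => θ v.1) sat =
      (fun y : a.localVars Z → GroundTerm Con =>
        a.elem.terms.map (ProgTerm.inst (override θ y))) ''
          {y | sat (a.elem.tau (override θ y))} := by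
  ext d
  constructor
  · rintro ⟨d, ⟨θ', hθ, hd, hs⟩, rfl⟩
    have h : ∀ v ∈ a.elem.vars,
        override θ (fun w : a.localVars Z => θ' w.1) v = θ' v := by
      intro v hv
      unfold override
      split_ifs with hl
      · rfl
      · refine (hθ ⟨v, Finset.mem_inter.2 ⟨hv, ?_⟩⟩).symm
        by_contra hZ
        exact hl (Finset.mem_sdiff.2 ⟨hv, hZ⟩)
    refine ⟨fun w => θ' w.1, ?_, ?_⟩
    · rw [Set.mem_ofPred_eq, AggElement.tau_congr h]
      exact hs
    · exact (map_inst_congr fun v hv => h v (Finset.mem_union_left _ hv)).trans hd.symm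
  · rintro ⟨y, hy, rfl⟩
    refine ⟨⟨_, a.elem.setSymbol Z, hS, (List.length_map _).symm⟩,
      ⟨override θ y, fun v => ?_, rfl, hy⟩, rfl⟩
    -- Members of `X` are global, so `override` leaves their values alone.
    have hv : v.1 ∉ a.localVars Z := fun h =>
      (Finset.mem_sdiff.1 h).2 (Finset.mem_inter.1 v.2).2
    simp [override, hv]

end Aggregates

/-! ### Satisfaction of the translation of a program in agg-ht-interpretations -/

section Translation

variable {Con Var : Type} [DecidableEq Var] {prog : Program Con Var}

theorem IsAggHT.standard_there [TermOrder Con] {H I : prog.Interp} (h : IsAggHT H I) :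
    IsStandard I := h.agg_there.1

variable [TermOrder Con]

/-- The right-hand side mentions only `Y` and `X`: the intended values of the set functions depend
on the ground atoms alone. -/
theorem SetSymbol.tuples_htSat {H I : prog.Interp} {Y X : Set (GroundAtom Con)}
    (hH : IsStandard H) (hI : IsStandard I) (hY : Represents H Y) (hX : Represents I X)
    (e : SetSymbol Con Var) (he : e ∈ prog.setSymbols) (a : e.params → GroundTerm Con) :
    e.tuples he .cli a (fun F ρ => F.HTSat H I ρ) =
      e.tauTuples prog.setSymbols a (fun F => F.HTSat Y X) :=
  Set.ext fun _ => exists_congr fun _ => and_congr_right fun _ => and_congr_right fun _ =>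
    e.elem.htSat_litsToFO hH hI hY hX (genAssign_agrees _ fun _ _ => rfl) _ _

theorem SetSymbol.tuples_sat {I : prog.Interp} {X : Set (GroundAtom Con)}
    (hI : IsStandard I) (hX : Represents I X)
    (e : SetSymbol Con Var) (he : e ∈ prog.setSymbols) (x : Sem) (a : e.params → GroundTerm Con) :
    e.tuples he x a (fun F ρ => F.Sat I ρ) =
      e.tauTuples prog.setSymbols a (fun F => F.Sat X) :=
  Set.ext fun _ => exists_congr fun _ => and_congr_right fun _ => and_congr_right fun _ =>
    e.elem.sat_litsToFO hI hX (genAssign_agrees _ fun _ _ => rfl) _ _ _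

theorem IsAggInterp.isAggHT_self {I : prog.Interp} (hI : IsAggInterp I) : IsAggHT I I where
  le := ⟨fun _ _ _ h => h, fun _ _ => rfl, fun _ _ => rfl⟩
  standard_here := hI.1
  agg_there := hI
  cli e he a := by
    simp only [Formula.htSat_self]
    exact hI.2 e he .cli a
  dlv e he a := hI.2 e he .dlv a

/-- `sat` is left abstract to serve both worlds: truth in `X` for the there-world, truth in `⟨Y, X⟩`
for the here-world. -/
theorem AggAtom.eval_op {I : prog.Interp} (hI : IsStandard I) (Z : Finset Var)
    (a : AggAtom Con Var) (hS : a.elem.setSymbol Z ∈ prog.setSymbols)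
    {sat : InfFormula (GroundAtom Con) → Prop}
    (hf : ∀ b, I.func (TFunc.setFn .cli _ hS) b =
      (a.elem.setSymbol Z).tauTuples prog.setSymbols b sat)
    {C : prog.sig.Ctx} {ρ : Assign (σ := prog.sig) (StdU prog.setSymbols) C}
    {θ : Var → GroundTerm Con} (hρ : Agrees ρ θ)
    (hC : Covers C (a.elem.setSymbol Z).params) :
    (Term.app (σ := prog.sig) (TFunc.op a.op) (fun _ : Unit =>
      (a.elem.setSymbol Z).toFO .cli hS hC)).eval I ρ =
      a.op.hat ((fun y : a.localVars Z → GroundTerm Con =>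
        a.elem.terms.map (ProgTerm.inst (override θ y))) ''
          {y | sat (a.elem.tau (override θ y))}) := by
  refine (hI.op a.op _).trans ?_
  rw [← a.image_tauTuples Z θ hS sat]
  refine congrArg (fun s => a.op.hat (Subtype.val '' s)) ((hf _).trans ?_)
  exact congrArg (fun b => (a.elem.setSymbol Z).tauTuples prog.setSymbols b sat)
    (funext fun v => hρ v.1 _)

/-- Evaluating the comparison in `I` and in `H` yields the two conditions of `AggAtom.htSat_tau`, in
the same order. -/
theorem AggAtom.htSat_toFO {H I : prog.Interp} {Y X : Set (GroundAtom Con)} (h : IsAggHT H I)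
    (hY : Represents H Y) (hX : Represents I X) {C : prog.sig.Ctx}
    {ρ : Assign (σ := prog.sig) (StdU prog.setSymbols) C} {θ : Var → GroundTerm Con}
    (hρ : Agrees ρ θ) (Z : Finset Var) (a : AggAtom Con Var)
    (hS : a.elem.setSymbol Z ∈ prog.setSymbols) (hC : Covers C (a.elem.setSymbol Z).params)
    (hg : Covers C a.guard.vars) :
    (cmpFO a.cmp (Term.app (σ := prog.sig) (TFunc.op a.op) (fun _ : Unit =>
      (a.elem.setSymbol Z).toFO .cli hS hC)) (a.guard.toFO hg)).HTSat H I ρ ↔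
      (a.tau Z θ).HTSat Y X := by
  have hI := h.standard_there
  have hH := h.standard_here
  rw [AggAtom.htSat_tau]
  refine htSat_cmpFO hH hI a.cmp ?_ (ProgTerm.eval_toFO hI hρ _ _) ?_
    (ProgTerm.eval_toFO hH hρ _ _)
  · exact a.eval_op hI Z hS (sat := fun F => F.Sat X) (fun b =>
      (h.agg_there.2 _ hS .cli b).trans (SetSymbol.tuples_sat hI hX _ hS _ b)) hρ hC
  · exact a.eval_op hH Z hS (sat := fun F => F.HTSat Y X) (fun b =>
      (h.cli _ hS b).trans (SetSymbol.tuples_htSat hH hI hY hX _ hS b)) hρ hC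

theorem Literal.htSat_toFO {H I : prog.Interp} {Y X : Set (GroundAtom Con)} (h : IsAggHT H I)
    (hY : Represents H Y) (hX : Represents I X) {C : prog.sig.Ctx}
    {ρ : Assign (σ := prog.sig) (StdU prog.setSymbols) C} {θ : Var → GroundTerm Con}
    (hρ : Agrees ρ θ) (Z : Finset Var) (B : Literal Con Var) (hP : B.preds ⊆ prog.preds)
    (hS : B.setSymbols Z ⊆ prog.setSymbols) (hB : B.globalVars ⊆ Z) (hC : Covers C Z) :
    (B.toFO .cli Z hP hS hB hC).HTSat H I ρ ↔ (B.tau Z θ).HTSat Y X := by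
  cases B with
  | basic l => exact l.htSat_toFO h.standard_here h.standard_there hY hX hρ _ _
  | agg sgn a =>
    refine sgn.htSat_toFO ?_ (a.htSat_toFO h hY hX hρ Z (hS rfl) _ _)
    rw [← Formula.htSat_self, ← InfFormula.htSat_self]
    exact a.htSat_toFO h.agg_there.isAggHT_self hX hX hρ Z (hS rfl) _ _

theorem htSat_headToFO {H I : prog.Interp} {Y X : Set (GroundAtom Con)} (h : IsAggHT H I)
    (hY : Represents H Y) (hX : Represents I X) {C : prog.sig.Ctx}
    {ρ : Assign (σ := prog.sig) (StdU prog.setSymbols) C} {θ : Var → GroundTerm Con}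
    (hρ : Agrees ρ θ) (A : Option (Atom Con (ProgTerm Con Var)))
    (hP : ∀ a, A = some a → a.symbol ∈ prog.preds) (hC : Covers C (headVars A)) :
    (headToFO A hP hC).HTSat H I ρ ↔ (headTau θ A).HTSat Y X := by
  cases A with
  | none => exact iff_of_false id (InfFormula.htSat_bot Y X)
  | some a => exact a.htSat_toFO h.standard_here h.standard_there hY hX hρ _ hC

/-- The matrix of the translation of a rule. -/
theorem Rule.htSat_imp {H I : prog.Interp} {Y X : Set (GroundAtom Con)} (h : IsAggHT H I)
    (hY : Represents H Y) (hX : Represents I X) {C : prog.sig.Ctx}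
    {ρ : Assign (σ := prog.sig) (StdU prog.setSymbols) C} {θ : Var → GroundTerm Con}
    (hρ : Agrees ρ θ) (R : Rule Con Var)
    (hP : ∀ B ∈ R.body, B.preds ⊆ prog.preds)
    (hS : ∀ B ∈ R.body, B.setSymbols R.globalVars ⊆ prog.setSymbols)
    (hB : ∀ B ∈ R.body, B.globalVars ⊆ R.globalVars) (hC : Covers C R.globalVars)
    (hP' : ∀ a, R.head = some a → a.symbol ∈ prog.preds) (hC' : Covers C (headVars R.head)) :
    (Formula.imp (.conj (R.body.attach.map fun B => B.1.toFO .cli R.globalVars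
      (hP B.1 B.2) (hS B.1 B.2) (hB B.1 B.2) hC)) (headToFO R.head hP' hC')).HTSat H I ρ ↔
    (InfFormula.imp (.conjList (R.body.map (Literal.tau R.globalVars θ)))
      (headTau θ R.head)).HTSat Y X := by
  -- Quantified over pairs because the classical half of the implication is the instance `⟨I, I⟩`.
  have key : ∀ {H I : prog.Interp} {Y X : Set (GroundAtom Con)} (_ : IsAggHT H I)
      (_ : Represents H Y) (_ : Represents I X),
      ((Formula.conj (R.body.attach.map fun B => B.1.toFO .cli R.globalVars
        (hP B.1 B.2) (hS B.1 B.2) (hB B.1 B.2) hC)).HTSat H I ρ →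
          (headToFO R.head hP' hC').HTSat H I ρ) ↔
      ((InfFormula.conjList (R.body.map (Literal.tau R.globalVars θ))).HTSat Y X →
        (headTau θ R.head).HTSat Y X) := by
    intro H I Y X h hY hX
    rw [Formula.htSat_conj, InfFormula.htSat_conjList, List.forall_mem_map, List.forall_mem_map]
    refine imp_congr ⟨fun hb B hB => ?_, fun hb B _ => ?_⟩ (htSat_headToFO h hY hX hρ _ _ _)
    · exact (B.htSat_toFO h hY hX hρ _ _ _ _ _).1 (hb ⟨B, hB⟩ (List.mem_attach _ _))
    · exact (B.1.htSat_toFO h hY hX hρ _ _ _ _ _).2 (hb B.1 B.2)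
  have h₁ := key h hY hX
  have h₂ := key h.agg_there.isAggHT_self hX hX
  simp only [Formula.htSat_self, InfFormula.htSat_self] at h₂
  exact and_congr h₂ (imp_iff_not_or.symm.trans h₁)

theorem Rule.htSat_toFO {H I : prog.Interp} {Y X : Set (GroundAtom Con)} (h : IsAggHT H I)
    (hY : Represents H Y) (hX : Represents I X) (R : Rule Con Var) (hP : R.preds ⊆ prog.preds)
    (hS : R.setSymbols ⊆ prog.setSymbols) :
    (R.toFO .cli hP hS).HTSat H I Assign.empty ↔ R.tau.HTSat Y X := by
  have key : ∀ (ρ : Assign (σ := prog.sig) (StdU prog.setSymbols) (genCtx R.globalVars ++ []))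
      (θ : Var → GroundTerm Con), Agrees ρ θ → _ := fun ρ θ hρ => R.htSat_imp h hY hX hρ
    (fun B hB _ hp => hP (Or.inr ⟨B, hB, hp⟩)) (fun B hB _ he => hS ⟨B, hB, he⟩)
    (fun B hB _ hv => Finset.mem_union_right _ (mem_unionOver hB hv))
    (covers_genCtx_append _ _) (fun a ha => hP (Or.inl ⟨a, ha, rfl⟩))
    (fun v hv => covers_genCtx_append _ _ v (Finset.mem_union_left _ hv))
  refine (Formula.htSat_alls _ _ _ _ _).trans ⟨fun hR z => ?_, fun hR ρ _ => ?_⟩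
  · refine (key (fun x hx => genAssign (override (fun _ => .inf) z) R.globalVars x
      ((List.append_nil _).subst hx)) _ fun v hv => rfl).1 (hR _ ?_)
    exact fun x hx => absurd hx List.not_mem_nil
  · refine (key ρ _ ?_).2
      (hR fun v => ρ (genVar v.1) (covers_genCtx_append _ _ _ v.2))
    intro v hv
    -- Every variable in the context of the closure is global, so the default `inf` is never
    -- reached.
    have hv' : v ∈ R.globalVars :=
      genVar_mem_genCtx.1 ((List.mem_append.1 hv).resolve_right List.not_mem_nil)
    simp [override, hv']

theorem Program.htModels_toFO {H I : prog.Interp} {Y X : Set (GroundAtom Con)}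
    (h : IsAggHT H I) (hY : Represents H Y) (hX : Represents I X) :
    HTModels H I (prog.toFO .cli) ↔ prog.tau.HTSat Y X := by
  constructor
  · exact fun hM R => (R.1.htSat_toFO h hY hX _ _).1 (hM _ ⟨R.1, R.2, rfl⟩)
  · rintro hM _ ⟨R, hR, rfl⟩
    exact (R.htSat_toFO h hY hX _ _).2 (hM ⟨R, hR⟩)

end Translation

/-! ### Interpretations determined by sets of ground atoms -/

section Canonical

variable {Con Var : Type} [DecidableEq Var] {prog : Program Con Var}

/-- A standard interpretation is represented by the set of ground atoms that it satisfies. -/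
theorem represents_groundAtoms (I : prog.Interp) : Represents I (groundAtoms I) := by
  -- The list is decoupled from `List.ofFn a`, so that the arity `n` can be replaced by its length
  -- and `a` by `l.get`.
  have key : ∀ (n : ℕ) (c : Con) (l : List (GroundTerm Con)) (a : Fin n → GroundTerm Con)
      (h : (c, n) ∈ prog.preds) (_ : l = List.ofFn a),
      I.pred (TPred.user (c, n) h) a ↔ (⟨c, l⟩ : GroundAtom Con) ∈ groundAtoms I := by
    intro n c l a h hl
    obtain rfl : l.length = n := by rw [hl, List.length_ofFn]
    have ha : a = l.get := List.ofFn_injective (hl.symm.trans (List.ofFn_get l).symm)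
    subst ha
    exact ⟨fun hI => ⟨h, hI⟩, fun ⟨_, hI⟩ => hI⟩
  rintro ⟨c, n⟩ h a
  exact key n c _ a h rfl

/-- The condition on `A.symbol` is needed because `Represents` does not constrain atoms of `X` whose
predicate symbols are foreign to the program. -/
theorem Represents.mem_groundAtoms {I : prog.Interp} {X : Set (GroundAtom Con)}
    (hX : Represents I X) (A : GroundAtom Con) :
    A ∈ groundAtoms I ↔ A.symbol ∈ prog.preds ∧ A ∈ X := by
  have h : ∀ h : A.symbol ∈ prog.preds,
      I.pred (TPred.user A.symbol h) (fun i : Fin A.args.length => A.args.get i) ↔ A ∈ X := by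
    intro h
    refine (hX _ h _).trans (iff_of_eq (congrArg (· ∈ X) ?_))
    exact congrArg (Atom.mk A.pred) (List.ofFn_get A.args)
  exact ⟨fun ⟨h', hA⟩ => ⟨h', (h h').1 hA⟩, fun ⟨h', hA⟩ => ⟨h', (h h').2 hA⟩⟩

theorem groundAtoms_subset_of_htLe {H I : prog.Interp}
    (h : HTLe (intPred prog) (intFunc prog) H I) : groundAtoms H ⊆ groundAtoms I :=
  fun _ ⟨hA, hH⟩ => ⟨hA, h.1 _ ⟨_, hA, rfl⟩ _ hH⟩

variable [TermOrder Con]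

/-- Standard interpretations are determined by their ground atoms and by the set-valued
functions. -/
theorem IsStandard.ext {H I : prog.Interp} (hH : IsStandard H) (hI : IsStandard I)
    (h : groundAtoms H = groundAtoms I)
    (hf : ∀ x e he a, H.func (TFunc.setFn x e he) a = I.func (TFunc.setFn x e he) a) :
    H = I := by
  have hfunc : H.func = I.func := by
    funext f a
    cases f with
    | const g => exact (hH.const g a).trans (hI.const g a).symm
    | tuple k h => exact Subtype.ext ((hH.tuple k h a).trans (hI.tuple k h a).symm)
    | op o => exact (hH.op o a).trans (hI.op o a).symm
    | setFn x e he => exact hf x e he a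
  have hpred : H.pred = I.pred := by
    funext p a
    refine propext ?_
    cases p with
    | user q hq =>
      refine (represents_groundAtoms H q hq a).trans ?_
      rw [h]
      exact (represents_groundAtoms I q hq a).symm
    | cmp c hc => exact (hH.cmp c hc a).trans (hI.cmp c hc a).symm
    | mem => exact (hH.mem a).trans (hI.mem a).symm
  cases H
  cases I
  cases hfunc
  cases hpred
  rfl

/-- Standardness fixes all non-intensional symbols, and `≼` does not compare intensional functions.
-/
theorem htLe_of_standard {H I : prog.Interp} (hH : IsStandard H) (hI : IsStandard I)
    (h : groundAtoms H ⊆ groundAtoms I) : HTLe (intPred prog) (intFunc prog) H I := by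
  refine ⟨?_, fun p hp => funext fun a => propext ?_, fun f hf => funext fun a => ?_⟩
  · rintro _ ⟨q, hq, rfl⟩ a ha
    exact (represents_groundAtoms I q hq a).2 (h ((represents_groundAtoms H q hq a).1 ha))
  · cases p with
    | user q hq => exact absurd ⟨q, hq, rfl⟩ hp
    | cmp c hc => exact (hH.cmp c hc a).trans (hI.cmp c hc a).symm
    | mem => exact (hH.mem a).trans (hI.mem a).symm
  · cases f with
    | const g => exact (hH.const g a).trans (hI.const g a).symm
    | tuple k h => exact Subtype.ext ((hH.tuple k h a).trans (hI.tuple k h a).symm)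
    | op o => exact (hH.op o a).trans (hI.op o a).symm
    | setFn x e he => exact absurd ⟨x, e, he, rfl⟩ hf

/-- Over equal sets of atoms here-and-there truth is classical truth, so the `cli` functions of `H`
and `I` agree; the `dlv` functions are classical in each world anyway. -/
theorem IsAggHT.eq_of_groundAtoms_eq {H I : prog.Interp} (h : IsAggHT H I)
    (heq : groundAtoms H = groundAtoms I) : H = I := by
  have hI := h.standard_there
  have hH := h.standard_here
  have hX := represents_groundAtoms I
  have hY : Represents H (groundAtoms I) := heq ▸ represents_groundAtoms H
  refine hH.ext hI heq fun x e he a => ?_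
  refine Eq.trans ?_ ((h.agg_there.2 e he x a).trans (e.tuples_sat hI hX he x a)).symm
  cases x with
  | cli =>
    refine (h.cli e he a).trans ((e.tuples_htSat hH hI hY hX he a).trans ?_)
    simp only [InfFormula.htSat_self]
  | dlv => exact (h.dlv e he a).trans (e.tuples_sat hH hY he .dlv a)

/-- Satisfaction in the pair `⟨Y, X⟩` for `cli`, and classical satisfaction by `Y` for `dlv`. -/
def Sem.HTSat {At : Type} (x : Sem) (Y X : Set At) (F : InfFormula At) : Prop :=
  match x with
  | .cli => F.HTSat Y X
  | .dlv => F.Sat Y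

/-- The standard interpretation that satisfies the ground atoms in `Y`, with the set-valued
functions determined by the pair `⟨Y, X⟩`. -/
noncomputable def stdInterp (prog : Program Con Var) (Y X : Set (GroundAtom Con)) : prog.Interp where
  func := fun f => match f with
    | .const g => fun _ => g
    | .tuple k h => fun a : Fin k → GroundTerm Con =>
      ⟨List.ofFn a, h.imp fun _ he => ⟨he.1, he.2.trans (List.length_ofFn (f := a)).symm⟩⟩
    | .op o => fun a : Unit → Set (TupleOf prog.setSymbols) => o.hat (Subtype.val '' a ())
    | .setFn x e _ => fun a : e.params → GroundTerm Con =>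
      e.tauTuples prog.setSymbols a (x.HTSat Y X)
  pred := fun p => match p with
    | .user q _ => fun a : Fin q.2 → GroundTerm Con =>
      (⟨q.1, List.ofFn a⟩ : GroundAtom Con) ∈ Y
    | .cmp c _ => fun a : Fin 2 → GroundTerm Con => c.Rel (a 0) (a 1)
    | .mem => fun a => Membership.mem (γ := Set (TupleOf prog.setSymbols)) (a .right) (a .left)

theorem isStandard_stdInterp (Y X : Set (GroundAtom Con)) :
    IsStandard (stdInterp prog Y X) where
  const _ _ := rfl
  cmp _ _ _ := Iff.rfl
  tuple _ _ _ := rfl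
  mem _ := Iff.rfl
  op _ _ := rfl

theorem represents_stdInterp (Y X : Set (GroundAtom Con)) :
    Represents (stdInterp prog Y X) Y := fun _ _ _ => Iff.rfl

theorem isAggInterp_stdInterp (X : Set (GroundAtom Con)) :
    IsAggInterp (stdInterp prog X X) := by
  refine ⟨isStandard_stdInterp X X, fun e he x a => ?_⟩
  rw [e.tuples_sat (isStandard_stdInterp X X) (represents_stdInterp X X)]
  refine congrArg (e.tauTuples prog.setSymbols a) (funext fun F => propext ?_)
  cases x with
  | cli => exact InfFormula.htSat_self X F
  | dlv => exact Iff.rfl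

/-- The conditions on the set functions of the here-world refer to that world itself, but without
circularity: literals inside aggregate elements are basic, so their truth involves no set function.
-/
theorem isAggHT_stdInterp {I : prog.Interp} (hI : IsAggInterp I) {Y : Set (GroundAtom Con)}
    (h : Y ⊆ groundAtoms I) : IsAggHT (stdInterp prog Y (groundAtoms I)) I where
  le := htLe_of_standard (isStandard_stdInterp _ _) hI.1 fun A hA =>
    h (((represents_stdInterp _ _).mem_groundAtoms A).1 hA).2
  standard_here := isStandard_stdInterp _ _
  agg_there := hI
  cli e he a := (e.tuples_htSat (isStandard_stdInterp _ _) hI.1 (represents_stdInterp _ _)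
    (represents_groundAtoms I) he a).symm
  dlv e he a := (e.tuples_sat (isStandard_stdInterp _ _) (represents_stdInterp _ _)
    he .dlv a).symm

/-! ### Agg-stable models and FT-stable models. -/

theorem Interp.models_toFO {I : prog.Interp} {X : Set (GroundAtom Con)} (hI : IsAggInterp I)
    (hX : Represents I X) : I.Models (prog.toFO .cli) ↔ prog.tau.Sat X := by
  rw [← InfFormula.htSat_self, ← Program.htModels_toFO hI.isAggHT_self hX hX]
  simp only [Interp.Models, HTModels, Formula.htSat_self]

/-- A counterexample `Y` to minimality gives the here-world `stdInterp prog Y (groundAtoms I)`; a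
counterexample `H` to stability gives the set `groundAtoms H`. -/
theorem isAggStable_iff {I : prog.Interp} (hI : IsAggInterp I) :
    IsAggStable I (prog.toFO .cli) ↔ InfFormula.IsFTStable (groundAtoms I) prog.tau := by
  have hX := represents_groundAtoms I
  rw [InfFormula.isFTStable_iff, ← Interp.models_toFO hI hX]
  unfold IsAggStable
  simp only [hI, true_and]
  refine and_congr_right fun _ => ⟨fun h Y hY hsat => ?_, ?_⟩
  · have hH := isAggHT_stdInterp hI hY.subset
    refine h ⟨_, hH, (Program.htModels_toFO hH (represents_stdInterp _ _) hX).2 hsat,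
      hH.le, fun heq => ?_⟩
    obtain ⟨A, hA, hAY⟩ := Set.exists_of_ssubset hY
    rw [← heq] at hA
    exact hAY (((represents_stdInterp _ _).mem_groundAtoms A).1 hA).2
  · rintro h ⟨H, hH, hM, hle, hne⟩
    refine h (groundAtoms H) ?_
      ((Program.htModels_toFO hH (represents_groundAtoms H) hX).1 hM)
    exact (groundAtoms_subset_of_htLe hle).ssubset_of_ne fun heq =>
      hne (hH.eq_of_groundAtoms_eq heq)

/-- Ground atoms with predicate symbols foreign to the program do not belong to answer sets. -/
theorem groundAtoms_stdInterp_of_isFTStable {X : Set (GroundAtom Con)}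
    (h : InfFormula.IsFTStable X prog.tau) : groundAtoms (stdInterp prog X X) = X := by
  have hI := (isAggInterp_stdInterp (prog := prog) X).isAggHT_self
  have hX := represents_stdInterp (prog := prog) X X
  have hsub : groundAtoms (stdInterp prog X X) ⊆ X := fun A hA => ((hX.mem_groundAtoms A).1 hA).2
  rw [InfFormula.isFTStable_iff] at h
  by_contra hne
  refine h.2 _ (hsub.ssubset_of_ne hne) ?_
  -- The interpretation is represented both by its own atoms and by `X`. Passing through the
  -- first-order side therefore exchanges the here-set for `X`, where truth is classical.
  rw [← Program.htModels_toFO hI (represents_groundAtoms _) hX,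
    Program.htModels_toFO hI hX hX, InfFormula.htSat_self]
  exact h.1

theorem foAnswerSets_toFO (prog : Program Con Var) :
    foAnswerSets (prog := prog) (prog.toFO .cli) = gringoAnswerSets prog := by
  ext X
  constructor
  · rintro ⟨I, hI, rfl⟩
    exact (isAggStable_iff hI.1).1 hI
  · intro hX
    have h := groundAtoms_stdInterp_of_isFTStable hX
    exact ⟨_, (isAggStable_iff (isAggInterp_stdInterp X)).2 (h.symm ▸ hX), h⟩

/-! ### Set comprehension axioms -/

/-- A substitution witnessing membership and an extension of `ρ` to the local variables carry the
same information about the variables of the element. -/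
theorem SetSymbol.mem_func_iff_exists {H I : prog.Interp} {Y X : Set (GroundAtom Con)}
    (h : IsAggHT H I)
    (hY : Represents H Y) (hX : Represents I X) (e : SetSymbol Con Var) (he : e ∈ prog.setSymbols)
    (ρ : Assign (σ := prog.sig) (StdU prog.setSymbols) (tupleVar :: (genCtx e.params ++ [])))
    (a : e.params → GroundTerm Con)
    (ha : ∀ v : e.params, ρ (genVar v.1)
      (List.mem_cons_of_mem _ (covers_genCtx_append _ _ v.1 v.2)) = a v) :
    Membership.mem (γ := Set (TupleOf prog.setSymbols)) (H.func (TFunc.setFn .cli e he) a)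
      (ρ tupleVar List.mem_cons_self) ↔
    (Formula.exs (genCtx (e.elem.vars \ e.params)) (.and
      (.eq (.var tupleVar (List.mem_append_right _ List.mem_cons_self))
        (e.elem.tupleToFO ⟨e, he, rfl⟩ e.covers))
      (e.elem.litsToFO .cli (Program.preds_of_setSymbol he) e.covers))).HTSat H I ρ := by
  have hI := h.standard_there
  have hH := h.standard_here
  rw [h.cli e he a, e.tuples_htSat hH hI hY hX, Formula.htSat_exs]
  have key : ∀ (θ : Var → GroundTerm Con)
      (ρ' : Assign (σ := prog.sig) (StdU prog.setSymbols)
        (genCtx (e.elem.vars \ e.params) ++ tupleVar :: (genCtx e.params ++ [])))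
      (_ : ρ'.Extends ρ) (_ : Agrees ρ' θ),
      (Formula.and (Formula.eq (.var tupleVar (List.mem_append_right _ List.mem_cons_self))
        (e.elem.tupleToFO ⟨e, he, rfl⟩ e.covers))
        (e.elem.litsToFO .cli (Program.preds_of_setSymbol he) e.covers)).HTSat H I ρ' ↔
      (ρ tupleVar List.mem_cons_self : TupleOf prog.setSymbols).1 =
        e.elem.terms.map (ProgTerm.inst θ) ∧ (e.elem.tau θ).HTSat Y X := by
    intro θ ρ' hρ' hθ
    have ht := hρ' tupleVar List.mem_cons_self tupleVar_notMem_genCtx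
    refine and_congr ?_ (e.elem.htSat_litsToFO hH hI hY hX hθ _ _)
    -- Tuple constructors are rigid, so the equation for `T` means the same in both worlds.
    have heval : ∀ {J : prog.Interp} (_ : IsStandard J),
        (ρ' tupleVar (List.mem_append_right _ List.mem_cons_self) =
          (e.elem.tupleToFO ⟨e, he, rfl⟩ e.covers).eval J ρ') ↔
        (ρ tupleVar List.mem_cons_self : TupleOf prog.setSymbols).1 =
          e.elem.terms.map (ProgTerm.inst θ) := by
      intro J hJ
      rw [ht, ← e.elem.eval_tupleToFO hJ hθ ⟨e, he, rfl⟩ e.covers]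
      exact Subtype.ext_iff
    exact (and_congr (heval hI) (heval hH)).trans and_self_iff
  constructor
  · rintro ⟨θ, hθ, ht, hs⟩
    classical
    -- Local variables take their values from `θ`; all others, `T` included, keep those of `ρ`.
    let ρ' : Assign (σ := prog.sig) (StdU prog.setSymbols)
        (genCtx (e.elem.vars \ e.params) ++ tupleVar :: (genCtx e.params ++ [])) :=
      fun x hx => if hL : x ∈ genCtx (e.elem.vars \ e.params) then genAssign θ _ x hL else
        ρ x ((List.mem_append.1 hx).resolve_left hL)
    have hext : ρ'.Extends ρ := fun x hx hL => by simp only [ρ', hL, dif_neg, not_false_iff]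
    refine ⟨ρ', hext, (key θ ρ' hext fun v hv => ?_).2 ⟨ht, hs⟩⟩
    by_cases hL : (genVar v : Σ s, prog.sig.OVar s) ∈ genCtx (e.elem.vars \ e.params)
    · simp only [ρ', hL, dif_pos]
      rfl
    · simp only [ρ', hL, dif_neg, not_false_iff]
      have hv' : v ∈ e.params := by
        have h₁ := (List.mem_append.1 hv).resolve_left hL
        have h₂ := (List.mem_cons.1 h₁).resolve_left genVar_ne_tupleVar
        exact genVar_mem_genCtx.1 ((List.mem_append.1 h₂).resolve_right List.not_mem_nil)
      exact (ha ⟨v, hv'⟩).trans (hθ ⟨v, hv'⟩).symm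
  · rintro ⟨ρ', hext, hρ'⟩
    classical
    let θ : Var → GroundTerm Con := fun v =>
      if hv : (genVar v : Σ s, prog.sig.OVar s) ∈
        genCtx (e.elem.vars \ e.params) ++ tupleVar :: (genCtx e.params ++ [])
      then ρ' (genVar v) hv else .inf
    have hθ : Agrees ρ' θ := fun v hv => (dif_pos hv).symm
    refine ⟨θ, fun v => ?_, (key θ ρ' hext hθ).1 hρ'⟩
    have hv₁ : (genVar v.1 : Σ s, prog.sig.OVar s) ∈ tupleVar :: (genCtx e.params ++ []) :=
      List.mem_cons_of_mem _ (covers_genCtx_append _ _ v.1 v.2)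
    rw [← hθ v.1 (List.mem_append_right _ hv₁), ← ha v]
    exact hext _ hv₁ fun hL => (Finset.mem_sdiff.1 (genVar_mem_genCtx.1 hL)).2 v.2

/-- Agg-ht-interpretations satisfy the set comprehension axioms. -/
theorem IsAggHT.htModels_sca {H I : prog.Interp} (h : IsAggHT H I) :
    HTModels H I prog.sca := by
  rintro _ ⟨e, he, rfl⟩
  refine (Formula.htSat_alls _ _ _ _ _).2 fun ρ₀ _ d => ?_
  have hY := represents_groundAtoms H
  have hX := represents_groundAtoms I
  have hhere := e.mem_func_iff_exists h hY hX he (ρ₀.cons tupleVar d) _ fun _ => rfl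
  have hthere := e.mem_func_iff_exists h.agg_there.isAggHT_self hX hX he
    (ρ₀.cons tupleVar d) _ fun _ => rfl
  rw [Formula.htSat_self] at hthere
  have hmem : ∀ {J : prog.Interp} (_ : IsStandard J),
      (memFO (.var tupleVar List.mem_cons_self) (e.toFO .cli he fun v hv =>
        List.mem_cons_of_mem _ (covers_genCtx_append _ _ v hv))).Sat J (ρ₀.cons tupleVar d) ↔
      Membership.mem (γ := Set (TupleOf prog.setSymbols)) (J.func (TFunc.setFn .cli e he) _)
        (ρ₀.cons tupleVar d tupleVar List.mem_cons_self) := fun hJ => hJ.mem _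
  have hsat := (hmem h.standard_there).trans hthere
  -- Membership must hold in both worlds. From left to right its here-part suffices; in the
  -- converse, membership in `I` comes from persistence of the right-hand side.
  refine ⟨(Formula.htSat_imp_of_sat hsat.1).2 fun hm => hhere.1 ((hmem h.standard_here).1 hm.2),
    (Formula.htSat_imp_of_sat hsat.2).2 fun hm => ⟨hsat.2 hm.sat, ?_⟩⟩
  exact (hmem h.standard_here).2 (hhere.2 hm)

/-- Both clauses of stability range over agg-interpretations and agg-ht-interpretations only, and
these satisfy SCA automatically. -/
theorem isAggStable_sca_union (I : prog.Interp) (Γ : Set (Sentence prog.sig)) :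
    IsAggStable I (prog.sca ∪ Γ) ↔ IsAggStable I Γ := by
  refine and_congr_right fun hI => and_congr ?_ (not_congr (exists_congr fun H =>
    and_congr_right fun hH => and_congr_left fun _ => ?_))
  · refine ⟨fun h F hF => h F (Or.inr hF), fun h F hF => hF.elim (fun hF => ?_) (h F)⟩
    exact (hI.isAggHT_self.htModels_sca F hF).sat
  · exact ⟨fun h F hF => h F (Or.inr hF), fun h F hF => hF.elim (hH.htModels_sca F) (h F)⟩

end Canonical

end AspAgg

theorem mainTheorem1 {Con Var : Type} [AspAgg.TermOrder Con] [DecidableEq Var]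
    (prog : AspAgg.Program Con Var) :
    AspAgg.foAnswerSets (prog := prog) (prog.toFO .cli) = AspAgg.gringoAnswerSets prog ∧
    AspAgg.foAnswerSets (prog := prog) (prog.sca ∪ prog.toFO .cli) =
      AspAgg.gringoAnswerSets prog := by
  refine ⟨AspAgg.foAnswerSets_toFO prog, ?_⟩
  rw [← AspAgg.foAnswerSets_toFO prog]
  unfold AspAgg.foAnswerSets
  simp only [AspAgg.isAggStable_sca_union]
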